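/- Let $\mathbb{K}$ be a field of characteristic $0$ and let $S=\mathbb{K}[x,y,z]$ with its standard grading and the degree reverse lexicographic term ordering $\mathrm{DegRevLex}$ with $x>y>z$. A graded $\mathbb{K}$-algebra $R=\bigoplus_{i\ge 0}R_i$ with $\dim_{\mathbb{K}}R_i<\infty$ has the strong Lefschetz property (SLP) if there is $\ell\in R_1$ such that the multiplication map $\times\ell^s\colon R_i\to R_{i+s}$ has full rank (that is, rank $\min\{\dim_{\mathbb{K}} R_i,\dim_{\mathbb{K}} R_{i+s}\}$) for all $i\ge 0$ and $s\ge 1$. For a homogeneous ideal $I$ of $S$, $\mathrm{rgin}(I)$ denotes the generic initial ideal of $I$ with respect to $\mathrm{DegRevLex}$, that is, the unique ideal $J$ for which there is a nonempty Zariski open set $U\subseteq \mathrm{GL}_3(\mathbb{K})$ such that the leading term ideal of $g(I)$ is $J$ for every $g\in U$. A monomial ideal $J$ of $S$ is an almost revlex ideal if, for every power-product $t$ in the minimal generating set of $J$, every power-product $t'$ with $\deg(t')=\deg(t)$ and $t'>_{\mathrm{DegRevLex}}t$ belongs to $J$. The Hilbert function of a homogeneous ideal $I$ is $d\mapsto\dim_{\mathbb{K}}I_d$.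 **Corollary.** Let $I$ be a homogeneous ideal of $S=\mathbb{K}[x,y,z]$ such that $S/I$ has the SLP. Then $\mathrm{rgin}(I)$ (exists and) is an almost revlex ideal, and it is uniquely determined by the Hilbert function of $I$: it is the only almost revlex ideal of $S$ with the same Hilbert function as $I$. In particular, if $I'$ is another homogeneous ideal of $S$ such that $S/I'$ has the SLP and $I'$ has the same Hilbert function as $I$, then $\mathrm{rgin}(I')=\mathrm{rgin}(I)$. -/

import Mathlib

open MvPolynomial
open scoped MonomialOrder

namespace Lefschetz

/-! ### The degree reverse lexicographic term ordering -/

/-- Exponent vectors in `n` variables, to be ordered by `DegRevLex`. -/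
def DegRevLex (n : ℕ) : Type := Fin n →₀ ℕ

namespace DegRevLex

noncomputable instance (n : ℕ) : AddCommMonoid (DegRevLex n) :=
  inferInstanceAs (AddCommMonoid (Fin n →₀ ℕ))

/-- The identity map to the type synonym. -/
noncomputable def of {n : ℕ} : (Fin n →₀ ℕ) ≃+ DegRevLex n := AddEquiv.refl (Fin n →₀ ℕ)

/-- Compare first the total degrees; ties are broken by the last variable whose exponents differ,
the larger exponent there giving the smaller power-product (see `degRevLex_lt_iff`). The two order
duals express `last variable first` and `larger exponent is smaller`. -/
noncomputable def key {n : ℕ} (a : DegRevLex n) : ℕ ×ₗ Lex ((Fin n)ᵒᵈ → ℕᵒᵈ) :=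
  toLex ((of.symm a).degree, toLex fun i => OrderDual.toDual (of.symm a (OrderDual.ofDual i)))

theorem key_injective {n : ℕ} : Function.Injective (key (n := n)) := by
  intro a b h
  have h2 := congrArg (fun p => ofLex (ofLex p).2) h
  exact of.symm.injective (Finsupp.ext fun i => congrFun h2 (OrderDual.toDual i))

noncomputable instance (n : ℕ) : LinearOrder (DegRevLex n) :=
  LinearOrder.lift' key key_injective

theorem lt_iff {n : ℕ} (a b : Fin n →₀ ℕ) :
    of a < of b ↔
      a.degree < b.degree ∨
        a.degree = b.degree ∧ ∃ i, (∀ j, i < j → a j = b j) ∧ b i < a i := by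
  change key (of a) < key (of b) ↔ _
  simp only [key, Prod.Lex.toLex_lt_toLex]
  exact Iff.rfl

instance (n : ℕ) : IsOrderedAddMonoid (DegRevLex n) where
  add_le_add_left a b h c := by
    obtain ⟨a, rfl⟩ := of.surjective a
    obtain ⟨b, rfl⟩ := of.surjective b
    obtain ⟨c, rfl⟩ := of.surjective c
    rcases h.lt_or_eq with h | h
    · refine le_of_lt ?_
      rw [← map_add, ← map_add]
      rw [lt_iff] at h ⊢
      simpa only [map_add, Finsupp.add_apply, add_lt_add_iff_right, add_left_inj] using h
    · rw [h]

theorem of_mono {n : ℕ} : Monotone (of (n := n)) := by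
  intro a b h
  rcases eq_or_ne a b with rfl | hne
  · exact le_refl _
  · refine le_of_lt ((lt_iff a b).2 (Or.inl ?_))
    obtain ⟨c, rfl⟩ := exists_add_of_le h
    have hc : c.degree ≠ 0 := fun h0 => hne (by simp [(Finsupp.degree_eq_zero_iff c).1 h0])
    rw [map_add]
    omega

instance (n : ℕ) : WellFoundedLT (DegRevLex n) := by
  refine ⟨RelEmbedding.wellFounded_iff_isEmpty.2 ⟨fun f => ?_⟩⟩
  obtain ⟨i, j, hij, h⟩ := wellQuasiOrdered_le (α := Fin n →₀ ℕ) (fun k => of.symm (f k))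
  have h' := of_mono h
  simp only [AddEquiv.apply_symm_apply] at h'
  exact absurd h' (not_le_of_gt (f.map_rel_iff.2 hij))

end DegRevLex

/-- The degree reverse lexicographic term ordering on the power-products in `n` variables,
with `X 0 > X 1 > ⋯ > X (n - 1)`. -/
noncomputable def degRevLex (n : ℕ) : MonomialOrder (Fin n) where
  syn := DegRevLex n
  toSyn := DegRevLex.of
  toSyn_monotone := DegRevLex.of_mono

theorem degRevLex_lt_iff {n : ℕ} (a b : Fin n →₀ ℕ) :
    a ≺[degRevLex n] b ↔
      a.degree < b.degree ∨
        a.degree = b.degree ∧ ∃ i, (∀ j, i < j → a j = b j) ∧ b i < a i :=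
  DegRevLex.lt_iff a b

variable {K : Type*} [Field K] {n : ℕ}

/-! ### Leading term ideals and generic initial ideals -/

/-- The leading term ideal of `I`, generated by the power-products `LT(f)` for nonzero `f ∈ I`. -/
noncomputable def leadingTermIdeal (m : MonomialOrder (Fin n))
    (I : Ideal (MvPolynomial (Fin n) K)) : Ideal (MvPolynomial (Fin n) K) :=
  Ideal.span {p | ∃ f ∈ I, f ≠ 0 ∧ p = monomial (m.degree f) 1}

/-- The linear change of coordinates `x_i ↦ ∑ j, g i j * x_j`. -/
noncomputable def coordChange (g : GL (Fin n) K) :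
    MvPolynomial (Fin n) K →ₐ[K] MvPolynomial (Fin n) K :=
  aeval fun i => ∑ j, C (g i j) * X j

/-- Zariski open subsets of `GL n K`: complements of the common zero sets of families of
polynomials in the matrix entries. -/
def IsZariskiOpen (U : Set (GL (Fin n) K)) : Prop :=
  ∃ P : Set (MvPolynomial (Fin n × Fin n) K),
    U = {g | ∃ p ∈ P, eval (fun ij : Fin n × Fin n => g ij.1 ij.2) p ≠ 0}

/-- `J` is the generic initial ideal of `I`: it is the leading term ideal of `g(I)` for all `g` in
some nonempty Zariski open subset of `GL n K`. -/
def IsGin (m : MonomialOrder (Fin n)) (I J : Ideal (MvPolynomial (Fin n) K)) : Prop :=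
  ∃ U : Set (GL (Fin n) K), IsZariskiOpen U ∧ U.Nonempty ∧
    ∀ g ∈ U, leadingTermIdeal m (I.map (coordChange g)) = J

open Classical in
/-- The generic initial ideal with respect to `DegRevLex`. (The value `⊥` is only used if there is
no generic initial ideal.) -/
noncomputable def rgin (I : Ideal (MvPolynomial (Fin n) K)) : Ideal (MvPolynomial (Fin n) K) :=
  if h : ∃ J, IsGin (degRevLex n) I J then h.choose else ⊥

/-! ### Almost revlex ideals -/

/-- Ideals generated by power-products. -/
def IsMonomialIdeal (I : Ideal (MvPolynomial (Fin n) K)) : Prop :=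
  ∃ A : Set (Fin n →₀ ℕ), I = Ideal.span ((fun a => monomial a (1 : K)) '' A)

/-- The power-product with exponent `t` is in the minimal generating set of the monomial ideal `I`:
it is in `I` and no proper divisor of it is. -/
def IsMinimalGenerator (I : Ideal (MvPolynomial (Fin n) K)) (t : Fin n →₀ ℕ) : Prop :=
  Minimal (fun a => monomial a (1 : K) ∈ I) t

/-- Almost revlex ideals. -/
def IsAlmostRevlex (I : Ideal (MvPolynomial (Fin n) K)) : Prop :=
  IsMonomialIdeal I ∧ ∀ t, IsMinimalGenerator I t →
    ∀ t' : Fin n →₀ ℕ, t'.degree = t.degree → t ≺[degRevLex n] t' → monomial t' (1 : K) ∈ I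

/-! ### Hilbert functions and the strong Lefschetz property -/

/-- The Hilbert function `d ↦ dim_K I_d` of a homogeneous ideal. -/
noncomputable def hilbertFunction (I : Ideal (MvPolynomial (Fin n) K)) (d : ℕ) : ℕ :=
  Module.finrank K
    ↥(I.restrictScalars K ⊓ homogeneousSubmodule (Fin n) K d : Submodule K (MvPolynomial (Fin n) K))

/-- The homogeneous component of degree `i` of `S / I`, the image of that of `S`. -/
noncomputable def quotientComponent (I : Ideal (MvPolynomial (Fin n) K)) (i : ℕ) :
    Submodule K (MvPolynomial (Fin n) K ⧸ I) :=
  (homogeneousSubmodule (Fin n) K i).map (Ideal.Quotient.mkₐ K I).toLinearMap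

/-- The strong Lefschetz property of a `K`-algebra with (finite-dimensional) homogeneous components
`R i`: for some `ℓ ∈ R 1`, multiplication by `ℓ ^ s` from `R i` to `R (i + s)` has full rank, i.e.
its image has the smaller one of the two dimensions, for all `i ≥ 0` and `s ≥ 1`. -/
def HasSLP {A : Type*} [CommRing A] [Algebra K A] (R : ℕ → Submodule K A) : Prop :=
  ∃ ℓ ∈ R 1, ∀ i s : ℕ, 1 ≤ s →
    Module.finrank K ↥((R i).map (LinearMap.mulLeft K (ℓ ^ s))) =
      min (Module.finrank K (R i)) (Module.finrank K (R (i + s)))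

end Lefschetz

-- The standard grading of the polynomial ring, used for homogeneous ideals.
attribute [local instance] MvPolynomial.gradedAlgebra

/-!
Adjoin the entries of a generic matrix as parameters and transform `I` by it. Finitely many leading
exponents of the resulting family generate all of them, so the exponents survive specialization
outside a hypersurface; conversely the rank of a family of forms can only drop under
specialization, so no specialization has more leading exponents in any degree than the family. Both
together give Galligo's theorem that `gin(I)` exists, and the semicontinuity of Hilbert functions.

In characteristic `0` the ideal `gin(I)` is strongly stable: if `s x_i` were a leading term and
`s x_j` with `x_j > x_i` were not, then a transvection `x_i ↦ x_i + p x_j` would produce the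
leading term `s x_j`, because the minor detecting it has a linear term in `p` whose coefficient is
the exponent of `x_i` in `s x_i`.

The `DegRevLex` leading term of a form has the smallest exponent of `z` among its terms, hence the
leading exponents of `I + (z ^ s)` are those of `I` together with the multiples of `z ^ s`. By
semicontinuity, a Lefschetz element for `S/I` then yields that `z` is one for `S/rgin(I)`. On the
basis of power-products outside `rgin(I)`, full rank of `z ^ s` is a matter of counting: it is
injective or all power-products of exponent less than `s` in `z` are in `rgin(I)`. For a minimal
generator divisible by exactly `z ^ s` the first is impossible, which settles the larger
power-products with a smaller exponent of `z`; in three variables the remaining ones have the same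
exponent of `z` and are reached by strong stability from `y` to `x`.

In the lowest degree where two almost revlex ideals differ, each of them contains a power-product
that the other misses, and is a minimal generator there; comparing the two contradicts the
definition.
-/

namespace Lefschetz

/-! ### Leading exponents -/

section LeadingExponents

variable {σ R : Type*} [CommRing R] {m : MonomialOrder σ}

/-- The exponents of the leading terms of the nonzero elements of `I`. Over a field they determine
`leadingTermIdeal m I`; over a ring of parameters, where leading coefficients need not be units,
they are compared with the leading exponents of the specializations of `I`. -/
def leadingExponents (m : MonomialOrder σ) (I : Ideal (MvPolynomial σ R)) : Set (σ →₀ ℕ) :=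
  {t | ∃ f ∈ I, f ≠ 0 ∧ m.degree f = t}

theorem degree_eq_of_coeff_ne_zero {f : MvPolynomial σ R} {t : σ →₀ ℕ} (ht : f.coeff t ≠ 0)
    (h : ∀ u, f.coeff u ≠ 0 → u ≼[m] t) : m.degree f = t :=
  m.toSyn.injective <| le_antisymm (m.degree_le_iff.2 fun u hu => h u (mem_support_iff.1 hu))
    (m.le_degree (mem_support_iff.2 ht))

theorem leadingExponents_mono {I J : Ideal (MvPolynomial σ R)} (h : I ≤ J) :
    leadingExponents m I ⊆ leadingExponents m J :=
  fun _ ⟨f, hf, hf0, ht⟩ => ⟨f, h hf, hf0, ht⟩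

theorem isUpperSet_leadingExponents (I : Ideal (MvPolynomial σ R)) :
    IsUpperSet (leadingExponents m I) := by
  classical
  rintro _ u htu ⟨f, hf, hf0, rfl⟩
  obtain ⟨v, rfl⟩ := exists_add_of_le htu
  have : Nontrivial R := nontrivial_of_ne _ _ (m.coeff_degree_ne_zero_iff.2 hf0)
  have hdeg : m.degree (f * monomial v 1) = m.degree f + v := by
    rw [m.degree_mul_of_isRegular_right hf0 (by simpa using isRegular_one),
      m.degree_monomial, if_neg one_ne_zero]
  exact ⟨f * monomial v 1, I.mul_mem_right _ hf,
    fun h => hf0 (monomial_one_mul_cancel_right_iff.1 (h.trans (zero_mul _).symm)), hdeg⟩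

theorem exists_isHomogeneous_of_mem_leadingExponents {I : Ideal (MvPolynomial σ R)}
    (hI : I.IsHomogeneous (homogeneousSubmodule σ R)) {t : σ →₀ ℕ}
    (ht : t ∈ leadingExponents m I) :
    ∃ f ∈ I, f.IsHomogeneous t.degree ∧ f ≠ 0 ∧ m.degree f = t := by
  classical
  obtain ⟨f, hf, hf0, rfl⟩ := ht
  set d := (m.degree f).degree
  have hc : coeff (m.degree f) (homogeneousComponent d f) ≠ 0 := by
    rw [coeff_homogeneousComponent, if_pos rfl]
    exact m.coeff_degree_ne_zero_iff.2 hf0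
  refine ⟨homogeneousComponent d f, homogeneousComponent_mem_of_mem hI hf d,
    homogeneousComponent_isHomogeneous d f, fun h => hc (by rw [h, coeff_zero]),
    degree_eq_of_coeff_ne_zero hc fun u hu => m.le_degree (mem_support_iff.2 fun hu' => hu ?_)⟩
  rw [coeff_homogeneousComponent, hu', ite_self]

theorem degree_degree_of_isHomogeneous {f : MvPolynomial σ R} {d : ℕ}
    (hf : f.IsHomogeneous d) (hf0 : f ≠ 0) : (m.degree f).degree = d := by
  by_contra h
  exact m.coeff_degree_ne_zero_iff.2 hf0 (hf.coeff_eq_zero h)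

theorem eq_zero_of_coeff_leadingExponents_eq_zero {I : Ideal (MvPolynomial σ R)}
    {f : MvPolynomial σ R} {d : ℕ} (hfI : f ∈ I) (hf : f.IsHomogeneous d)
    (h : ∀ t ∈ leadingExponents m I, t.degree = d → f.coeff t = 0) : f = 0 := by
  by_contra hf0
  exact m.coeff_degree_ne_zero_iff.2 hf0
    (h _ ⟨f, hfI, hf0, rfl⟩ (degree_degree_of_isHomogeneous hf hf0))

theorem finite_setOf_mem_and_degree_eq [Finite σ] (M : Set (σ →₀ ℕ)) (d : ℕ) :
    {t ∈ M | t.degree = d}.Finite :=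
  (Finsupp.finite_of_degree_eq d).subset fun _ ht => ht.2

theorem card_le_ncard_leadingExponents [Finite σ] [Nontrivial R] {ι : Type*} [Fintype ι]
    (I : Ideal (MvPolynomial σ R)) {d : ℕ}
    {v : ι → MvPolynomial σ R} (hv : LinearIndependent R v) (hvI : ∀ i, v i ∈ I)
    (hvd : ∀ i, (v i).IsHomogeneous d) :
    Fintype.card ι ≤ {t ∈ leadingExponents m I | t.degree = d}.ncard := by
  set M := {t ∈ leadingExponents m I | t.degree = d}
  have := (finite_setOf_mem_and_degree_eq (leadingExponents m I) d).fintype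
  rw [Set.ncard_eq_toFinset_card', Set.toFinset_card]
  let coeffs : (ι → R) →ₗ[R] (M → R) :=
    (LinearMap.pi fun t => lcoeff R t.1) ∘ₗ Fintype.linearCombination R v
  refine card_le_of_injective R coeffs ((injective_iff_map_eq_zero _).2 fun c hc => ?_)
  have hcomb : Fintype.linearCombination R v c = 0 := by
    rw [Fintype.linearCombination_apply]
    refine eq_zero_of_coeff_leadingExponents_eq_zero (m := m) (d := d)
      ((I.restrictScalars R).sum_mem fun i _ => (I.restrictScalars R).smul_mem _ (hvI i))
      ((homogeneousSubmodule σ R d).sum_mem fun i _ => Submodule.smul_mem _ _ (hvd i))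
      fun t ht htd => congrFun hc ⟨t, ht, htd⟩
  exact funext (Fintype.linearIndependent_iff.1 hv c hcomb)

theorem linearIndependent_of_degree_injective [IsDomain R] {ι : Type*} {f : ι → MvPolynomial σ R}
    (hf0 : ∀ i, f i ≠ 0) (hinj : Function.Injective fun i => m.degree (f i)) :
    LinearIndependent R f := by
  classical
  rw [linearIndependent_iff']
  intro s g hg i hi
  by_contra hne
  obtain ⟨j, hj, hmax⟩ := (s.filter fun i => g i ≠ 0).exists_max_image
    (fun i => m.toSyn (m.degree (f i))) ⟨i, Finset.mem_filter.2 ⟨hi, hne⟩⟩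
  rw [Finset.mem_filter] at hj
  have hcoeff : g j * coeff (m.degree (f j)) (f j) = 0 := by
    rw [← smul_eq_mul, ← coeff_smul, ← coeff_zero (m.degree (f j)), ← hg, coeff_sum,
      Finset.sum_eq_single_of_mem j hj.1 fun k hk hkj => ?_]
    by_cases hgk : g k = 0
    · rw [hgk, zero_smul, coeff_zero]
    · rw [coeff_smul, m.coeff_eq_zero_of_lt, smul_zero]
      exact (hmax k (Finset.mem_filter.2 ⟨hk, hgk⟩)).lt_of_ne fun h =>
        hkj (hinj (m.toSyn.injective h))
  exact (mul_ne_zero hj.2 (m.coeff_degree_ne_zero_iff.2 (hf0 j))) hcoeff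

end LeadingExponents

section HilbertFunction

variable {K : Type*} [Field K] {n : ℕ} {m : MonomialOrder (Fin n)}

instance finiteDimensional_homogeneousSubmodule (d : ℕ) :
    FiniteDimensional K (homogeneousSubmodule (Fin n) K d) :=
  Module.Finite.iff_fg.2 (homogeneousSubmodule_fg _ _ d)

instance finiteDimensional_inf_homogeneousSubmodule (V : Submodule K (MvPolynomial (Fin n) K))
    (d : ℕ) : FiniteDimensional K ↥(V ⊓ homogeneousSubmodule (Fin n) K d) :=
  Submodule.finiteDimensional_of_le (inf_le_right : _ ≤ homogeneousSubmodule (Fin n) K d)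

theorem hilbertFunction_mono {I J : Ideal (MvPolynomial (Fin n) K)} (h : I ≤ J) (d : ℕ) :
    hilbertFunction I d ≤ hilbertFunction J d :=
  Submodule.finrank_mono (inf_le_inf_right _ h)

theorem exists_linearIndependent_of_hilbertFunction (I : Ideal (MvPolynomial (Fin n) K)) (d : ℕ) :
    ∃ v : Fin (hilbertFunction I d) → MvPolynomial (Fin n) K, LinearIndependent K v ∧
      (∀ i, v i ∈ I) ∧ ∀ i, (v i).IsHomogeneous d := by
  let b := Module.finBasis K
    ↥(I.restrictScalars K ⊓ homogeneousSubmodule (Fin n) K d : Submodule K (MvPolynomial (Fin n) K))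
  exact ⟨fun i => (b i).1, b.linearIndependent.map' (Submodule.subtype _) (Submodule.ker_subtype _),
    fun i => (b i).2.1, fun i => (b i).2.2⟩

theorem hilbertFunction_eq_ncard (m : MonomialOrder (Fin n)) {I : Ideal (MvPolynomial (Fin n) K)}
    (hI : I.IsHomogeneous (homogeneousSubmodule (Fin n) K)) (d : ℕ) :
    hilbertFunction I d = {t ∈ leadingExponents m I | t.degree = d}.ncard := by
  apply le_antisymm
  · obtain ⟨v, hv, hvI, hvd⟩ := exists_linearIndependent_of_hilbertFunction I d
    simpa only [Fintype.card_fin] using card_le_ncard_leadingExponents I hv hvI hvd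
  · set M := {t ∈ leadingExponents m I | t.degree = d}
    have := (finite_setOf_mem_and_degree_eq (leadingExponents m I) d).fintype
    have hforms : ∀ t : M, ∃ f : ↥(I.restrictScalars K ⊓ homogeneousSubmodule (Fin n) K d :
        Submodule K (MvPolynomial (Fin n) K)), f.1 ≠ 0 ∧ m.degree f.1 = t.1 := by
      rintro ⟨t, ht, rfl⟩
      obtain ⟨f, hf, hfd, hf0, hft⟩ := exists_isHomogeneous_of_mem_leadingExponents hI ht
      exact ⟨⟨f, hf, hfd⟩, hf0, hft⟩
    choose f hf0 hft using hforms
    have hindep : LinearIndependent K f := by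
      refine .of_comp (Submodule.subtype _) (linearIndependent_of_degree_injective (m := m) hf0
        fun s t hst => Subtype.ext ?_)
      simpa [hft] using hst
    rw [Set.ncard_eq_toFinset_card', Set.toFinset_card]
    exact hindep.fintype_card_le_finrank

theorem exists_mem_coeff_eq_ite {I : Ideal (MvPolynomial (Fin n) K)}
    (hI : I.IsHomogeneous (homogeneousSubmodule (Fin n) K)) (t : Fin n →₀ ℕ) :
    ∃ f ∈ I, f.IsHomogeneous t.degree ∧ ∀ s ∈ leadingExponents m I, s.degree = t.degree →
      coeff s f = if s = t then 1 else 0 := by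
  set M := {s ∈ leadingExponents m I | s.degree = t.degree}
  have := (finite_setOf_mem_and_degree_eq (leadingExponents m I) t.degree).fintype
  set V : Submodule K (MvPolynomial (Fin n) K) :=
    I.restrictScalars K ⊓ homogeneousSubmodule (Fin n) K t.degree
  let coeffs : V →ₗ[K] (M → K) := (LinearMap.pi fun s => lcoeff K s.1) ∘ₗ V.subtype
  have hinj : Function.Injective coeffs := (injective_iff_map_eq_zero _).2 fun f hf =>
    Subtype.ext <| eq_zero_of_coeff_leadingExponents_eq_zero f.2.1 f.2.2 fun s hs hst =>
      congrFun hf ⟨s, hs, hst⟩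
  have hrank : Module.finrank K V = Module.finrank K (M → K) := by
    rw [Module.finrank_fintype_fun_eq_card, ← Set.toFinset_card, ← Set.ncard_eq_toFinset_card']
    exact hilbertFunction_eq_ncard m hI t.degree
  obtain ⟨f, hf⟩ := (LinearMap.injective_iff_surjective_of_finrank_eq_finrank hrank).1 hinj
    fun s => if s.1 = t then 1 else 0
  exact ⟨f, f.2.1, f.2.2, fun s hs hst => congrFun hf ⟨s, hs, hst⟩⟩

theorem leadingTermIdeal_eq_span (I : Ideal (MvPolynomial (Fin n) K)) :
    leadingTermIdeal m I =
      Ideal.span ((fun a => monomial a (1 : K)) '' leadingExponents m I) := by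
  unfold leadingTermIdeal leadingExponents
  congr 1
  ext p
  simp only [Set.mem_ofPred_eq, Set.mem_image]
  grind

theorem monomial_mem_span_iff {M : Set (Fin n →₀ ℕ)} (hM : IsUpperSet M) (t : Fin n →₀ ℕ) :
    monomial t (1 : K) ∈ Ideal.span ((fun a => monomial a (1 : K)) '' M) ↔ t ∈ M := by
  classical
  rw [mem_ideal_span_monomial_image]
  simp only [support_monomial, one_ne_zero, if_false, Finset.mem_singleton, forall_eq]
  exact ⟨fun ⟨s, hs, hst⟩ => hM hst hs, fun h => ⟨t, h, le_rfl⟩⟩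

theorem monomial_mem_leadingTermIdeal_iff {I : Ideal (MvPolynomial (Fin n) K)} {t : Fin n →₀ ℕ} :
    monomial t (1 : K) ∈ leadingTermIdeal m I ↔ t ∈ leadingExponents m I := by
  rw [leadingTermIdeal_eq_span, monomial_mem_span_iff (isUpperSet_leadingExponents I)]

theorem isMonomialIdeal_leadingTermIdeal (I : Ideal (MvPolynomial (Fin n) K)) :
    IsMonomialIdeal (leadingTermIdeal m I) :=
  ⟨_, leadingTermIdeal_eq_span I⟩

theorem isUpperSet_setOf_monomial_mem (J : Ideal (MvPolynomial (Fin n) K)) :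
    IsUpperSet {t | monomial t (1 : K) ∈ J} := by
  intro t u htu ht
  obtain ⟨v, rfl⟩ := exists_add_of_le htu
  have hmul : monomial (t + v) (1 : K) = monomial t 1 * monomial v 1 := by
    rw [monomial_mul, mul_one]
  change monomial (t + v) (1 : K) ∈ J
  exact hmul ▸ J.mul_mem_right _ ht

theorem IsMonomialIdeal.eq_span {J : Ideal (MvPolynomial (Fin n) K)} (hJ : IsMonomialIdeal J) :
    J = Ideal.span ((fun a => monomial a (1 : K)) '' {t | monomial t (1 : K) ∈ J}) := by
  refine le_antisymm ?_ (Ideal.span_le.2 (Set.image_subset_iff.2 fun t ht => ht))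
  obtain ⟨A, rfl⟩ := hJ
  exact Ideal.span_mono (Set.image_mono fun t ht => Ideal.subset_span ⟨t, ht, rfl⟩)

theorem IsMonomialIdeal.isHomogeneous {J : Ideal (MvPolynomial (Fin n) K)}
    (hJ : IsMonomialIdeal J) : J.IsHomogeneous (homogeneousSubmodule (Fin n) K) := by
  obtain ⟨A, rfl⟩ := hJ
  apply Ideal.homogeneous_span
  rintro _ ⟨t, -, rfl⟩
  exact ⟨t.degree, isHomogeneous_monomial 1 rfl⟩

theorem IsMonomialIdeal.leadingExponents_eq {J : Ideal (MvPolynomial (Fin n) K)}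
    (hJ : IsMonomialIdeal J) : leadingExponents m J = {t | monomial t (1 : K) ∈ J} := by
  classical
  ext t
  constructor
  · rintro ⟨f, hf, hf0, rfl⟩
    rw [hJ.eq_span] at hf
    obtain ⟨s, hs, hst⟩ := mem_ideal_span_monomial_image.1 hf _ (m.degree_mem_support hf0)
    exact isUpperSet_setOf_monomial_mem J hst hs
  · exact fun ht => ⟨_, ht, by simp, by rw [m.degree_monomial, if_neg one_ne_zero]⟩

theorem IsMonomialIdeal.hilbertFunction_eq_ncard {J : Ideal (MvPolynomial (Fin n) K)}
    (hJ : IsMonomialIdeal J) (d : ℕ) :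
    hilbertFunction J d = {t : Fin n →₀ ℕ | monomial t (1 : K) ∈ J ∧ t.degree = d}.ncard := by
  rw [Lefschetz.hilbertFunction_eq_ncard (degRevLex n) hJ.isHomogeneous, hJ.leadingExponents_eq]
  rfl

theorem IsMonomialIdeal.eq_of_forall_monomial_mem_iff {J J' : Ideal (MvPolynomial (Fin n) K)}
    (hJ : IsMonomialIdeal J) (hJ' : IsMonomialIdeal J')
    (h : ∀ t, monomial t (1 : K) ∈ J ↔ monomial t (1 : K) ∈ J') : J = J' := by
  rw [hJ.eq_span, hJ'.eq_span]
  simp only [h]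

theorem leadingExponents_leadingTermIdeal (I : Ideal (MvPolynomial (Fin n) K)) :
    leadingExponents m (leadingTermIdeal m I) = leadingExponents m I := by
  simp only [(isMonomialIdeal_leadingTermIdeal I).leadingExponents_eq,
    monomial_mem_leadingTermIdeal_iff, Set.ofPred_mem_eq]

theorem hilbertFunction_leadingTermIdeal {I : Ideal (MvPolynomial (Fin n) K)}
    (hI : I.IsHomogeneous (homogeneousSubmodule (Fin n) K)) :
    hilbertFunction (leadingTermIdeal m I) = hilbertFunction I := by
  funext d
  simp only [hilbertFunction_eq_ncard m hI,
    (isMonomialIdeal_leadingTermIdeal I).hilbertFunction_eq_ncard,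
    monomial_mem_leadingTermIdeal_iff]

end HilbertFunction

/-! ### Uniqueness of almost revlex ideals -/

section Uniqueness

variable {K : Type*} [Field K] {n : ℕ}

theorem isMinimalGenerator_of_notMem {J J' : Ideal (MvPolynomial (Fin n) K)} {t : Fin n →₀ ℕ}
    (hlt : ∀ u : Fin n →₀ ℕ, u.degree < t.degree → monomial u (1 : K) ∈ J →
      monomial u (1 : K) ∈ J')
    (ht : monomial t (1 : K) ∈ J) (ht' : monomial t (1 : K) ∉ J') : IsMinimalGenerator J t := by
  refine ⟨ht, fun u hu hut => ?_⟩
  obtain ⟨v, rfl⟩ := exists_add_of_le hut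
  have hv : v.degree = 0 := by
    by_contra hv
    refine ht' (isUpperSet_setOf_monomial_mem J' hut (hlt u ?_ hu))
    rw [map_add]
    omega
  rw [(Finsupp.degree_eq_zero_iff v).1 hv, add_zero]

theorem IsAlmostRevlex.lt_of_mem_of_notMem {J J' : Ideal (MvPolynomial (Fin n) K)}
    (hJ : IsAlmostRevlex J) {t u : Fin n →₀ ℕ} (htu : t.degree = u.degree)
    (hlt : ∀ v : Fin n →₀ ℕ, v.degree < t.degree → monomial v (1 : K) ∈ J →
      monomial v (1 : K) ∈ J')
    (ht : monomial t (1 : K) ∈ J) (ht' : monomial t (1 : K) ∉ J') (hu : monomial u (1 : K) ∉ J) :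
    u ≺[degRevLex n] t := by
  rcases lt_trichotomy ((degRevLex n).toSyn t) ((degRevLex n).toSyn u) with h | h | h
  · exact absurd (hJ.2 t (isMinimalGenerator_of_notMem hlt ht ht') u htu.symm h) hu
  · exact absurd ((degRevLex n).toSyn.injective h ▸ ht) hu
  · exact h

theorem IsAlmostRevlex.eq_of_hilbertFunction_eq {J J' : Ideal (MvPolynomial (Fin n) K)}
    (hJ : IsAlmostRevlex J) (hJ' : IsAlmostRevlex J')
    (h : hilbertFunction J = hilbertFunction J') : J = J' := by
  refine hJ.1.eq_of_forall_monomial_mem_iff hJ'.1 fun t => ?_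
  induction hd : t.degree using Nat.strong_induction_on generalizing t with
  | _ d ih =>
    let M (L : Ideal (MvPolynomial (Fin n) K)) : Set (Fin n →₀ ℕ) :=
      {u | monomial u (1 : K) ∈ L ∧ u.degree = d}
    have hfin (L) : (M L).Finite := finite_setOf_mem_and_degree_eq {u | monomial u (1 : K) ∈ L} d
    have hcard : (M J).ncard = (M J').ncard := by
      rw [← hJ.1.hilbertFunction_eq_ncard, ← hJ'.1.hilbertFunction_eq_ncard, h]
    suffices hM : M J = M J' by simpa [M, hd] using Set.ext_iff.1 hM t
    by_contra hne
    obtain ⟨u, ⟨huJ, hu⟩, hu'⟩ : (M J \ M J').Nonempty := Set.sdiff_nonempty.2 fun hsub =>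
      hne (Set.eq_of_subset_of_ncard_le hsub hcard.ge (hfin J'))
    obtain ⟨v, ⟨hvJ', hv⟩, hv'⟩ : (M J' \ M J).Nonempty := Set.sdiff_nonempty.2 fun hsub =>
      hne (Set.eq_of_subset_of_ncard_le hsub hcard.le (hfin J)).symm
    have huJ' : monomial u (1 : K) ∉ J' := fun h => hu' ⟨h, hu⟩
    have hvJ : monomial v (1 : K) ∉ J := fun h => hv' ⟨h, hv⟩
    have hvu := hJ.lt_of_mem_of_notMem (hu.trans hv.symm)
      (fun w hw => (ih _ (hu ▸ hw) w rfl).1) huJ huJ' hvJ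
    have huv := hJ'.lt_of_mem_of_notMem (hv.trans hu.symm)
      (fun w hw => (ih _ (hv ▸ hw) w rfl).2) hvJ' hvJ huJ'
    exact lt_asymm hvu huv

end Uniqueness

/-! ### Linear substitutions -/

section LinearSubst

variable {K A B : Type*} [CommRing K] [CommRing A] [Algebra K A] [CommRing B] [Algebra K B] {n : ℕ}

theorem isHomogeneous_ideal_map {σ R S F : Type*} [CommRing R] [CommRing S]
    [FunLike F (MvPolynomial σ R) (MvPolynomial σ S)]
    [RingHomClass F (MvPolynomial σ R) (MvPolynomial σ S)] (Φ : F)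
    (hΦ : ∀ (f : MvPolynomial σ R) (d : ℕ), f.IsHomogeneous d → (Φ f).IsHomogeneous d)
    {I : Ideal (MvPolynomial σ R)} (hI : I.IsHomogeneous (homogeneousSubmodule σ R)) :
    (I.map Φ).IsHomogeneous (homogeneousSubmodule σ S) := by
  obtain ⟨S, rfl⟩ := (Ideal.IsHomogeneous.iff_exists _ _).1 hI
  rw [Ideal.map_span]
  apply Ideal.homogeneous_span
  rintro _ ⟨_, ⟨⟨f, d, hf⟩, -, rfl⟩, rfl⟩
  exact ⟨d, hΦ f d hf⟩

/-- The linear substitution `x_i ↦ ∑ j, M i j * x_j` with coefficients in a `K`-algebra `A`. For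
`A = K` it is a change of coordinates, polynomial rings `A` give families of these. -/
noncomputable def linearSubst (M : Matrix (Fin n) (Fin n) A) :
    MvPolynomial (Fin n) K →ₐ[K] MvPolynomial (Fin n) A :=
  aeval fun i => ∑ j, C (M i j) * X j

theorem linearSubst_X (M : Matrix (Fin n) (Fin n) A) (i : Fin n) :
    linearSubst (K := K) M (X i) = ∑ j, C (M i j) * X j :=
  aeval_X _ _

theorem map_linearSubst (φ : A →ₐ[K] B) (M : Matrix (Fin n) (Fin n) A)
    (f : MvPolynomial (Fin n) K) : map φ (linearSubst M f) = linearSubst (φ.mapMatrix M) f := by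
  have h : (mapAlgHom φ).comp (linearSubst (K := K) M) = linearSubst (φ.mapMatrix M) :=
    MvPolynomial.algHom_ext fun i => by simp [linearSubst_X]
  exact DFunLike.congr_fun h f

theorem isHomogeneous_linearSubst (M : Matrix (Fin n) (Fin n) A) {f : MvPolynomial (Fin n) K}
    {d : ℕ} (hf : f.IsHomogeneous d) : (linearSubst M f).IsHomogeneous d := by
  have h := hf.aeval (fun i => ∑ j, C (M i j) * X j) (n := 1)
    fun i => IsHomogeneous.sum _ _ _ fun j _ => isHomogeneous_C_mul_X _ _
  rwa [one_mul] at h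

theorem isHomogeneous_map_linearSubst (M : Matrix (Fin n) (Fin n) A)
    {I : Ideal (MvPolynomial (Fin n) K)} (hI : I.IsHomogeneous (homogeneousSubmodule (Fin n) K)) :
    (I.map (linearSubst M)).IsHomogeneous (homogeneousSubmodule (Fin n) A) :=
  isHomogeneous_ideal_map _ (fun _ _ => isHomogeneous_linearSubst M) hI

theorem map_map_linearSubst (φ : A →ₐ[K] B) (M : Matrix (Fin n) (Fin n) A)
    (I : Ideal (MvPolynomial (Fin n) K)) :
    (I.map (linearSubst M)).map (map (φ : A →+* B)) = I.map (linearSubst (φ.mapMatrix M)) := by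
  refine Eq.trans (Ideal.map_mapₐ (linearSubst M) (mapAlgHom φ)) ?_
  congr 1
  exact AlgHom.ext (map_linearSubst φ M)

end LinearSubst

section CoordChange

variable {K : Type*} [Field K] {n : ℕ}

theorem coordChange_eq_linearSubst (g : GL (Fin n) K) : coordChange g = linearSubst g.1 :=
  rfl

theorem coordChange_one : coordChange (1 : GL (Fin n) K) = AlgHom.id K _ :=
  MvPolynomial.algHom_ext fun i => by simp [coordChange, Matrix.one_apply]

theorem coordChange_comp (g h : GL (Fin n) K) :
    (coordChange g).comp (coordChange h) = coordChange (h * g) := by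
  refine MvPolynomial.algHom_ext fun i => ?_
  simp only [AlgHom.comp_apply, coordChange_eq_linearSubst, linearSubst_X, map_sum, map_mul,
    algHom_C, algebraMap_eq, Finset.mul_sum, Units.val_mul, Matrix.mul_apply, Finset.sum_mul,
    mul_assoc]
  exact Finset.sum_comm

theorem coordChange_injective (g : GL (Fin n) K) : Function.Injective (coordChange g) := by
  refine Function.LeftInverse.injective (g := coordChange g⁻¹) fun f => ?_
  rw [← AlgHom.comp_apply, coordChange_comp, mul_inv_cancel, coordChange_one, AlgHom.id_apply]

theorem map_coordChange_mul (g h : GL (Fin n) K) (I : Ideal (MvPolynomial (Fin n) K)) :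
    I.map (coordChange (g * h)) = (I.map (coordChange g)).map (coordChange h) := by
  rw [Ideal.map_mapₐ, coordChange_comp]

theorem hilbertFunction_map_coordChange (g : GL (Fin n) K) (I : Ideal (MvPolynomial (Fin n) K)) :
    hilbertFunction (I.map (coordChange g)) = hilbertFunction I := by
  have hle (g : GL (Fin n) K) (I : Ideal (MvPolynomial (Fin n) K)) (d : ℕ) :
      hilbertFunction I d ≤ hilbertFunction (I.map (coordChange g)) d := by
    have e := Submodule.equivMapOfInjective (coordChange g).toLinearMap (coordChange_injective g)
    rw [hilbertFunction, (e _).finrank_eq]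
    refine Submodule.finrank_mono (Submodule.map_le_iff_le_comap.2 fun f hf => ?_)
    exact ⟨Ideal.mem_map_of_mem _ hf.1, isHomogeneous_linearSubst g.1 hf.2⟩
  funext d
  refine le_antisymm ?_ (hle g I d)
  have hinv := hle g⁻¹ (I.map (coordChange g)) d
  rwa [← map_coordChange_mul, mul_inv_cancel, coordChange_one,
    show I.map (AlgHom.id K _) = I from Ideal.map_id I] at hinv

end CoordChange

/-! ### Zariski open sets of matrices -/

section EvalEntries

variable {K A : Type*} [CommRing K] [CommRing A] [Algebra K A] {n : ℕ}

/-- Evaluation of polynomials in the matrix entries, at a matrix over a `K`-algebra. -/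
noncomputable def evalEntries (M : Matrix (Fin n) (Fin n) A) :
    MvPolynomial (Fin n × Fin n) K →ₐ[K] A :=
  aeval fun ij => M ij.1 ij.2

theorem mapMatrix_evalEntries_mvPolynomialX (M : Matrix (Fin n) (Fin n) A) :
    (evalEntries (K := K) M).mapMatrix (Matrix.mvPolynomialX (Fin n) (Fin n) K) = M := by
  ext i j
  simp [evalEntries]

theorem map_evalEntries {B : Type*} [CommRing B] [Algebra K B] (φ : A →ₐ[K] B)
    (M : Matrix (Fin n) (Fin n) A) (P : MvPolynomial (Fin n × Fin n) K) :
    φ (evalEntries M P) = evalEntries (φ.mapMatrix M) P := by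
  simp [evalEntries, ← comp_aeval_apply]

end EvalEntries

section Zariski

variable {K : Type*} [Field K] {n : ℕ}

theorem isZariskiOpen_iff {U : Set (GL (Fin n) K)} :
    IsZariskiOpen U ↔ ∃ Ps : Set (MvPolynomial (Fin n × Fin n) K),
      U = {g | ∃ P ∈ Ps, evalEntries g.1 P ≠ 0} := by
  simp only [IsZariskiOpen, evalEntries, aeval_eq_eval]

theorem isZariskiOpen_setOf_evalEntries_ne_zero (P : MvPolynomial (Fin n × Fin n) K) :
    IsZariskiOpen {g : GL (Fin n) K | evalEntries g.1 P ≠ 0} :=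
  isZariskiOpen_iff.2 ⟨{P}, by simp⟩

theorem exists_evalEntries_ne_zero [Infinite K] {P : MvPolynomial (Fin n × Fin n) K}
    (hP : P ≠ 0) : ∃ g : GL (Fin n) K, evalEntries g.1 P ≠ 0 := by
  obtain ⟨M, hM⟩ : ∃ M, eval M (P * (Matrix.mvPolynomialX (Fin n) (Fin n) K).det) ≠ 0 := by
    by_contra! h
    exact mul_ne_zero hP (Matrix.det_mvPolynomialX_ne_zero _ _)
      (MvPolynomial.funext fun M => by rw [h M, map_zero])
  rw [map_mul, Matrix.eval_det_mvPolynomialX] at hM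
  exact ⟨Matrix.GeneralLinearGroup.mkOfDetNeZero _ (right_ne_zero_of_mul hM),
    left_ne_zero_of_mul hM⟩

theorem IsZariskiOpen.inter_nonempty [Infinite K] {U V : Set (GL (Fin n) K)}
    (hU : IsZariskiOpen U) (hV : IsZariskiOpen V) (hU' : U.Nonempty) (hV' : V.Nonempty) :
    (U ∩ V).Nonempty := by
  obtain ⟨Ps, rfl⟩ := isZariskiOpen_iff.1 hU
  obtain ⟨Qs, rfl⟩ := isZariskiOpen_iff.1 hV
  obtain ⟨g, P, hP, hgP⟩ := hU'
  obtain ⟨h, Q, hQ, hhQ⟩ := hV'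
  have hPQ : P * Q ≠ 0 :=
    mul_ne_zero (fun h0 => hgP (by rw [h0, map_zero])) (fun h0 => hhQ (by rw [h0, map_zero]))
  obtain ⟨k, hk⟩ := exists_evalEntries_ne_zero hPQ
  rw [map_mul] at hk
  exact ⟨k, ⟨P, hP, left_ne_zero_of_mul hk⟩, ⟨Q, hQ, right_ne_zero_of_mul hk⟩⟩

theorem IsGin.unique [Infinite K] {m : MonomialOrder (Fin n)}
    {I J J' : Ideal (MvPolynomial (Fin n) K)} (h : IsGin m I J) (h' : IsGin m I J') : J = J' := by
  obtain ⟨U, hU, hUn, hUJ⟩ := h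
  obtain ⟨V, hV, hVn, hVJ⟩ := h'
  obtain ⟨g, hgU, hgV⟩ := hU.inter_nonempty hV hUn hVn
  rw [← hUJ g hgU, hVJ g hgV]

theorem IsZariskiOpen.exists_forall_eval_ne_zero_mem {U : Set (GL (Fin n) K)}
    (hU : IsZariskiOpen U) {γ : K → GL (Fin n) K} (M : Matrix (Fin n) (Fin n) (Polynomial K))
    (hM : ∀ p, (γ p).1 = (Polynomial.aeval p).mapMatrix M) {p₀ : K} (h₀ : γ p₀ ∈ U) :
    ∃ q : Polynomial K, q ≠ 0 ∧ ∀ p, q.eval p ≠ 0 → γ p ∈ U := by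
  obtain ⟨Ps, rfl⟩ := isZariskiOpen_iff.1 hU
  obtain ⟨P, hP, hP₀⟩ := h₀
  have heval (p : K) : (evalEntries M P).eval p = evalEntries (γ p).1 P := by
    rw [hM, ← map_evalEntries, Polynomial.coe_aeval_eq_eval]
  refine ⟨evalEntries M P, fun h => hP₀ ?_, fun p hp => ⟨P, hP, heval p ▸ hp⟩⟩
  rw [← heval, h, Polynomial.eval_zero]

end Zariski

/-! ### Specialization of families of ideals -/

section Specialization

variable {σ A B k : Type*} [CommRing A] [CommRing B] [Field k] {m : MonomialOrder σ}

theorem exists_ne_zero_leadingExponents_subset_map [IsDomain A] [Finite σ] (m : MonomialOrder σ)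
    (I : Ideal (MvPolynomial σ A)) :
    ∃ a : A, a ≠ 0 ∧ ∀ φ : A →+* B, φ a ≠ 0 →
      leadingExponents m I ⊆ leadingExponents m (I.map (map φ)) := by
  have hfin : {t | Minimal (· ∈ leadingExponents m I) t}.Finite :=
    WellQuasiOrderedLE.finite_of_isAntichain (setOfPred_minimal_antichain _)
  have hwitness : ∀ t, Minimal (· ∈ leadingExponents m I) t → ∃ f ∈ I, f ≠ 0 ∧ m.degree f = t :=
    fun t ht => ht.1
  choose! f hfI hf0 hft using hwitness
  refine ⟨∏ t ∈ hfin.toFinset, (f t).coeff t, Finset.prod_ne_zero_iff.2 fun t ht => ?_,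
    fun φ hφ u hu => ?_⟩
  · have ht' := hfin.mem_toFinset.1 ht
    simpa only [hft t ht'] using m.coeff_degree_ne_zero_iff.2 (hf0 t ht')
  obtain ⟨t, htu, ht⟩ := exists_minimal_le_of_wellFoundedLT _ u hu
  refine isUpperSet_leadingExponents _ htu ?_
  have hcoeff : coeff t (map φ (f t)) ≠ 0 := fun h => hφ <| by
    rw [map_prod]
    exact Finset.prod_eq_zero (hfin.mem_toFinset.2 ht) (by rwa [coeff_map] at h)
  refine ⟨map φ (f t), Ideal.mem_map_of_mem _ (hfI t ht), fun h => hcoeff (by rw [h, coeff_zero]),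
    degree_eq_of_coeff_ne_zero hcoeff fun v hv => ?_⟩
  rw [← hft t ht]
  exact m.le_degree (mem_support_iff.2 fun h => hv (by rw [coeff_map, h, map_zero]))

theorem linearIndependent_of_map [IsDomain A] {φ : A →+* k} (hφ : Function.Surjective φ)
    {ι : Type*} [Finite ι] {v : ι → MvPolynomial σ A}
    (hv : LinearIndependent k fun i => map φ (v i)) : LinearIndependent A v := by
  classical
  cases nonempty_fintype ι
  obtain ⟨L, hL⟩ := LinearMap.exists_leftInverse_of_injective _
    (LinearMap.ker_eq_bot.2 (linearIndependent_iff_injective_fintypeLinearCombination.1 hv))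
  let L' : MvPolynomial σ A →ₗ[A] (ι → A) :=
    (basisMonomials σ A).constr A fun u i => Function.surjInv hφ (L (monomial u 1) i)
  have hL' (f : MvPolynomial σ A) (i : ι) : φ (L' f i) = L (map φ f) i := by
    induction f using MvPolynomial.induction_on' with
    | monomial u a =>
      have hmul (b : A) : monomial u b = b • basisMonomials σ A u := by
        simp [smul_monomial]
      have hmul' : map φ (monomial u a) = φ a • monomial u 1 := by simp [smul_monomial]
      rw [hmul', hmul, map_smul, map_smul, (basisMonomials σ A).constr_basis]
      simp [Function.surjInv_eq]
    | add p q hp hq => simp only [map_add, Pi.add_apply, hp, hq]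
  have hdet : (Matrix.of fun i j => L' (v i) j).det ≠ 0 := fun h => by
    have hone : φ.mapMatrix (Matrix.of fun i j => L' (v i) j) = 1 := by
      ext i j
      have hLv := congrFun (DFunLike.congr_fun hL (Pi.single i 1)) j
      simp only [LinearMap.comp_apply, Fintype.linearCombination_apply_single, one_smul,
        LinearMap.id_apply] at hLv
      rw [RingHom.mapMatrix_apply, Matrix.map_apply, Matrix.of_apply, hL', hLv, Matrix.one_apply,
        Pi.single_apply]
      simp only [eq_comm]
    have := φ.map_det (Matrix.of fun i j => L' (v i) j)
    rw [hone, h, map_zero, Matrix.det_one] at this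
    exact zero_ne_one this
  exact .of_comp L' (Matrix.linearIndependent_rows_of_det_ne_zero hdet)

theorem exists_isHomogeneous_map_eq {φ : A →+* k} (hφ : Function.Surjective φ)
    {I : Ideal (MvPolynomial σ A)} (hI : I.IsHomogeneous (homogeneousSubmodule σ A))
    {f : MvPolynomial σ k} {d : ℕ} (hf : f ∈ I.map (map φ)) (hfd : f.IsHomogeneous d) :
    ∃ F ∈ I, F.IsHomogeneous d ∧ map φ F = f := by
  obtain ⟨F, hF, rfl⟩ := (Ideal.mem_map_iff_of_surjective _ (map_surjective φ hφ)).1 hf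
  refine ⟨homogeneousComponent d F, homogeneousComponent_mem_of_mem hI hF d,
    homogeneousComponent_isHomogeneous d F, ?_⟩
  rw [← homogeneousComponent_eq_self hfd]
  ext t
  simp only [coeff_map, coeff_homogeneousComponent, apply_ite φ, map_zero]

theorem hilbertFunction_map_le_ncard [IsDomain A] {n : ℕ} (m : MonomialOrder (Fin n))
    {φ : A →+* k} (hφ : Function.Surjective φ) {I : Ideal (MvPolynomial (Fin n) A)}
    (hI : I.IsHomogeneous (homogeneousSubmodule (Fin n) A)) (d : ℕ) :
    hilbertFunction (I.map (map φ)) d ≤ {t ∈ leadingExponents m I | t.degree = d}.ncard := by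
  obtain ⟨v, hv, hvI, hvd⟩ := exists_linearIndependent_of_hilbertFunction (I.map (map φ)) d
  choose V hVI hVd hV using fun i => exists_isHomogeneous_map_eq hφ hI (hvI i) (hvd i)
  have hindep : LinearIndependent A V := linearIndependent_of_map hφ (by simpa only [hV] using hv)
  simpa only [Fintype.card_fin] using card_le_ncard_leadingExponents I hindep hVI hVd

end Specialization

/-! ### Existence of generic initial ideals -/

section Existence

variable {K : Type*} [Field K] {n : ℕ} {m : MonomialOrder (Fin n)}

/-- The specialization at `g` of a polynomial whose coefficients are polynomials in the matrix
entries. -/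
noncomputable def specialize (g : GL (Fin n) K) :
    MvPolynomial (Fin n) (MvPolynomial (Fin n × Fin n) K) →+* MvPolynomial (Fin n) K :=
  map (evalEntries g.1 : MvPolynomial (Fin n × Fin n) K →ₐ[K] K).toRingHom

theorem isHomogeneous_map_specialize (g : GL (Fin n) K)
    {I : Ideal (MvPolynomial (Fin n) (MvPolynomial (Fin n × Fin n) K))}
    (hI : I.IsHomogeneous (homogeneousSubmodule (Fin n) _)) :
    (I.map (specialize g)).IsHomogeneous (homogeneousSubmodule (Fin n) K) :=
  isHomogeneous_ideal_map _ (fun _ _ hf => hf.map _) hI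

theorem exists_isZariskiOpen_leadingExponents_subset [Infinite K] (m : MonomialOrder (Fin n))
    (I : Ideal (MvPolynomial (Fin n) (MvPolynomial (Fin n × Fin n) K))) :
    ∃ U : Set (GL (Fin n) K), IsZariskiOpen U ∧ U.Nonempty ∧
      ∀ g ∈ U, leadingExponents m I ⊆ leadingExponents m (I.map (specialize g)) := by
  obtain ⟨P, hP0, hP⟩ := exists_ne_zero_leadingExponents_subset_map (B := K) m I
  exact ⟨{g | evalEntries g.1 P ≠ 0}, isZariskiOpen_setOf_evalEntries_ne_zero P,
    exists_evalEntries_ne_zero hP0,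
    fun g hg => hP (evalEntries g.1 : MvPolynomial (Fin n × Fin n) K →ₐ[K] K).toRingHom hg⟩

theorem hilbertFunction_map_specialize_le_ncard (m : MonomialOrder (Fin n))
    {I : Ideal (MvPolynomial (Fin n) (MvPolynomial (Fin n × Fin n) K))}
    (hI : I.IsHomogeneous (homogeneousSubmodule (Fin n) _)) (g : GL (Fin n) K) (d : ℕ) :
    hilbertFunction (I.map (specialize g)) d ≤ {t ∈ leadingExponents m I | t.degree = d}.ncard :=
  hilbertFunction_map_le_ncard m (fun a => ⟨C a, (evalEntries g.1).commutes a⟩) hI d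

theorem exists_isZariskiOpen_hilbertFunction_map_specialize_le [Infinite K]
    {I : Ideal (MvPolynomial (Fin n) (MvPolynomial (Fin n × Fin n) K))}
    (hI : I.IsHomogeneous (homogeneousSubmodule (Fin n) _)) :
    ∃ U : Set (GL (Fin n) K), IsZariskiOpen U ∧ U.Nonempty ∧
      ∀ g ∈ U, ∀ (h : GL (Fin n) K) (d : ℕ),
        hilbertFunction (I.map (specialize h)) d ≤ hilbertFunction (I.map (specialize g)) d := by
  obtain ⟨U, hU, hUn, hsub⟩ := exists_isZariskiOpen_leadingExponents_subset (degRevLex n) I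
  refine ⟨U, hU, hUn, fun g hg h d => ?_⟩
  rw [hilbertFunction_eq_ncard (degRevLex n) (isHomogeneous_map_specialize g hI)]
  refine (hilbertFunction_map_specialize_le_ncard (degRevLex n) hI h d).trans ?_
  exact Set.ncard_le_ncard (fun u hu => ⟨hsub g hg hu.1, hu.2⟩)
    (finite_setOf_mem_and_degree_eq _ d)

/-- The family over the matrix entries whose member at `g` is the transform of `I` by
`coordChange g`. -/
noncomputable def genericTransform (I : Ideal (MvPolynomial (Fin n) K)) :
    Ideal (MvPolynomial (Fin n) (MvPolynomial (Fin n × Fin n) K)) :=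
  I.map (linearSubst (Matrix.mvPolynomialX (Fin n) (Fin n) K))

theorem genericTransform_map_specialize (I : Ideal (MvPolynomial (Fin n) K)) (g : GL (Fin n) K) :
    (genericTransform I).map (specialize g) = I.map (coordChange g) := by
  rw [genericTransform, specialize, AlgHom.toRingHom_eq_coe, map_map_linearSubst,
    mapMatrix_evalEntries_mvPolynomialX, coordChange_eq_linearSubst]

theorem isHomogeneous_genericTransform {I : Ideal (MvPolynomial (Fin n) K)}
    (hI : I.IsHomogeneous (homogeneousSubmodule (Fin n) K)) :
    (genericTransform I).IsHomogeneous (homogeneousSubmodule (Fin n) _) :=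
  isHomogeneous_map_linearSubst _ hI

theorem isHomogeneous_map_coordChange (g : GL (Fin n) K) {I : Ideal (MvPolynomial (Fin n) K)}
    (hI : I.IsHomogeneous (homogeneousSubmodule (Fin n) K)) :
    (I.map (coordChange g)).IsHomogeneous (homogeneousSubmodule (Fin n) K) :=
  isHomogeneous_map_linearSubst g.1 hI

theorem exists_isGin [Infinite K] (m : MonomialOrder (Fin n)) {I : Ideal (MvPolynomial (Fin n) K)}
    (hI : I.IsHomogeneous (homogeneousSubmodule (Fin n) K)) : ∃ J, IsGin m I J := by
  obtain ⟨U, hU, hUn, hsub⟩ :=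
    exists_isZariskiOpen_leadingExponents_subset m (genericTransform I)
  refine ⟨Ideal.span ((fun a => monomial a (1 : K)) '' leadingExponents m (genericTransform I)),
    U, hU, hUn, fun g hg => ?_⟩
  specialize hsub g hg
  rw [genericTransform_map_specialize] at hsub
  rw [leadingTermIdeal_eq_span]
  congr 2
  refine Set.Subset.antisymm (fun t ht => ?_) hsub
  have hcard := hilbertFunction_map_specialize_le_ncard m (isHomogeneous_genericTransform hI) g
    t.degree
  rw [genericTransform_map_specialize,
    hilbertFunction_eq_ncard m (isHomogeneous_map_coordChange g hI)] at hcard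
  have hslice : {u ∈ leadingExponents m (genericTransform I) | u.degree = t.degree} ⊆
      {u ∈ leadingExponents m (I.map (coordChange g)) | u.degree = t.degree} :=
    fun u hu => ⟨hsub hu.1, hu.2⟩
  exact ((Set.eq_of_subset_of_ncard_le hslice hcard
    (finite_setOf_mem_and_degree_eq _ _)).ge ⟨ht, rfl⟩).1

theorem isGin_rgin [Infinite K] {I : Ideal (MvPolynomial (Fin n) K)}
    (hI : I.IsHomogeneous (homogeneousSubmodule (Fin n) K)) :
    IsGin (degRevLex n) I (rgin I) := by
  have h := exists_isGin (degRevLex n) hI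
  rw [rgin, dif_pos h]
  exact h.choose_spec

theorem IsGin.isMonomialIdeal {I J : Ideal (MvPolynomial (Fin n) K)} (h : IsGin m I J) :
    IsMonomialIdeal J := by
  obtain ⟨U, -, ⟨g, hg⟩, hJ⟩ := h
  exact hJ g hg ▸ isMonomialIdeal_leadingTermIdeal _

theorem IsGin.hilbertFunction_eq {I J : Ideal (MvPolynomial (Fin n) K)} (h : IsGin m I J)
    (hI : I.IsHomogeneous (homogeneousSubmodule (Fin n) K)) :
    hilbertFunction J = hilbertFunction I := by
  obtain ⟨U, -, ⟨g, hg⟩, hJ⟩ := h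
  rw [← hJ g hg, hilbertFunction_leadingTermIdeal (isHomogeneous_map_coordChange g hI),
    hilbertFunction_map_coordChange]

end Existence

/-! ### Strong stability -/

section Transvection

variable {K : Type*} [CommRing K] {n : ℕ}

theorem exists_linearSubst_transvection_X_eq (i j : Fin n) (f : MvPolynomial (Fin n) K) :
    ∃ R, linearSubst (Matrix.transvection i j Polynomial.X) f =
      map Polynomial.C f + C Polynomial.X * map Polynomial.C (X j * pderiv i f) +
        C (Polynomial.X ^ 2) * R := by
  have hX (k : Fin n) : linearSubst (K := K) (Matrix.transvection i j Polynomial.X) (X k) =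
      X k + C Polynomial.X * map Polynomial.C (X j * pderiv i (X k : MvPolynomial _ K)) := by
    simp only [linearSubst_X, Matrix.transvection, Matrix.add_apply, Matrix.one_apply,
      Matrix.single_apply, map_add (C : Polynomial K →+* _), add_mul, Finset.sum_add_distrib,
      pderiv_X, Pi.single_apply]
    by_cases hik : i = k <;> simp [hik, Ne.symm, apply_ite C, ite_mul]
  induction f using MvPolynomial.induction_on with
  | C a => exact ⟨0, by simp [linearSubst, IsScalarTower.algebraMap_apply K (Polynomial K)]⟩
  | add f g hf hg =>
    obtain ⟨R, hR⟩ := hf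
    obtain ⟨S, hS⟩ := hg
    refine ⟨R + S, ?_⟩
    rw [map_add, hR, hS]
    simp only [map_add, mul_add]
    ring
  | mul_X f k hf =>
    obtain ⟨R, hR⟩ := hf
    refine ⟨map Polynomial.C (X j * pderiv i f) * map Polynomial.C (X j * pderiv i (X k)) +
      R * (X k + C Polynomial.X * map Polynomial.C (X j * pderiv i (X k))), ?_⟩
    rw [map_mul, hR, hX, pderiv_mul]
    simp only [map_add, map_mul, map_pow, map_X]
    ring

theorem coeff_zero_coeff_linearSubst_transvection_X (i j : Fin n) (f : MvPolynomial (Fin n) K)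
    (v : Fin n →₀ ℕ) :
    ((linearSubst (Matrix.transvection i j Polynomial.X) f).coeff v).coeff 0 = f.coeff v := by
  obtain ⟨R, hR⟩ := exists_linearSubst_transvection_X_eq i j f
  rw [hR]
  simp only [coeff_add, coeff_C_mul, coeff_map, Polynomial.coeff_add, Polynomial.coeff_C_zero,
    Polynomial.coeff_X_mul_zero, Polynomial.coeff_X_pow_mul']
  simp

theorem coeff_one_coeff_linearSubst_transvection_X (i j : Fin n) (f : MvPolynomial (Fin n) K)
    (v : Fin n →₀ ℕ) :
    ((linearSubst (Matrix.transvection i j Polynomial.X) f).coeff v).coeff 1 =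
      (X j * pderiv i f).coeff v := by
  obtain ⟨R, hR⟩ := exists_linearSubst_transvection_X_eq i j f
  rw [hR]
  simp only [coeff_add, coeff_C_mul, coeff_map, Polynomial.coeff_add, Polynomial.coeff_C,
    Polynomial.coeff_X_mul, Polynomial.coeff_X_pow_mul']
  simp

theorem coeff_X_mul_pderiv_single_add {i j : Fin n} (f : MvPolynomial (Fin n) K)
    (s : Fin n →₀ ℕ) :
    (X j * pderiv i f).coeff (Finsupp.single j 1 + s) =
      f.coeff (s + Finsupp.single i 1) * (s i + 1) := by
  rw [coeff_X_mul, coeff_pderiv]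

theorem mapMatrix_aeval_transvection_X (i j : Fin n) (p : K) :
    (Polynomial.aeval p).mapMatrix (Matrix.transvection i j (Polynomial.X : Polynomial K)) =
      Matrix.transvection i j p := by
  ext a b
  simp [Matrix.transvection, Matrix.one_apply, Matrix.single_apply, apply_ite (Polynomial.eval p)]

end Transvection

section StrongStability

variable {K : Type*} [Field K] {n : ℕ} {m : MonomialOrder (Fin n)}

theorem det_ne_zero_of_coeff_zero_eq_of_coeff_one_eq {T : Type*} [Fintype T] [DecidableEq T]
    {A : Matrix T T (Polynomial K)} {τ : T}
    (hA : ∀ u ≠ τ, ∀ v ≠ τ, (A u v).coeff 0 = if v = u then 1 else 0)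
    (hτ₀ : ∀ v, (A τ v).coeff 0 = 0) (hτ₁ : ∀ v, (A τ v).coeff 1 = 0 ↔ v ≠ τ) : A.det ≠ 0 := by
  set B := A.updateRow τ fun v => (A τ v).divX
  have hAB : A.det = Polynomial.X * B.det := by
    have hrow : A τ = (Polynomial.X : Polynomial K) • fun v => (A τ v).divX := by
      ext1 v
      have h := Polynomial.X_mul_divX_add (A τ v)
      rw [hτ₀, map_zero, add_zero] at h
      exact h.symm
    rw [← Matrix.det_updateRow_smul, ← hrow, Matrix.updateRow_eq_self]
  have hB : Polynomial.constantCoeff.mapMatrix B =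
      (1 : Matrix T T K).updateCol τ fun u => (B u τ).coeff 0 := by
    ext u v
    rcases eq_or_ne v τ with rfl | hv
    · simp
    rcases eq_or_ne u τ with rfl | hu
    · simpa [B, hv, hv.symm, Polynomial.coeff_divX, Matrix.one_apply] using (hτ₁ v).2 hv
    · simpa [B, hv, hu, Matrix.one_apply, eq_comm] using hA u hu v hv
  have hdet : Polynomial.constantCoeff B.det ≠ 0 := by
    rw [RingHom.map_det, hB, ← Matrix.cramer_apply, Matrix.cramer_one]
    simpa [B, Polynomial.coeff_divX] using (hτ₁ τ).not_left.2 rfl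
  rw [hAB]
  exact mul_ne_zero Polynomial.X_ne_zero fun h => hdet (by rw [h, map_zero])

theorem exists_mem_coeff_eq_of_det_ne_zero {T : Type*} [Fintype T] [DecidableEq T]
    {I : Ideal (MvPolynomial (Fin n) K)} {d : ℕ} {F : T → MvPolynomial (Fin n) K}
    (hFI : ∀ u, F u ∈ I) (hFd : ∀ u, (F u).IsHomogeneous d) (e : T → Fin n →₀ ℕ)
    (hdet : (Matrix.of fun u v => (F u).coeff (e v)).det ≠ 0) (w : T → K) :
    ∃ G ∈ I, G.IsHomogeneous d ∧ ∀ v, G.coeff (e v) = w v := by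
  set A := Matrix.of fun u v => (F u).coeff (e v)
  set c := Matrix.vecMul w A⁻¹
  refine ⟨∑ u, c u • F u, sum_mem fun u _ => I.smul_of_tower_mem _ (hFI u),
    IsHomogeneous.sum _ _ _ fun u _ => (homogeneousSubmodule _ K d).smul_mem _ (hFd u),
    fun v => ?_⟩
  have hc : Matrix.vecMul c A = w := by
    rw [Matrix.vecMul_vecMul, Matrix.nonsing_inv_mul _ hdet.isUnit, Matrix.vecMul_one]
  rw [← congrFun hc v, coeff_sum]
  simp [Matrix.vecMul, dotProduct, A]

theorem coeff_X_mul_pderiv_eq_zero_iff [CharZero K] {f : MvPolynomial (Fin n) K} (hf0 : f ≠ 0)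
    {i j : Fin n} {s v : Fin n →₀ ℕ} (hf : m.degree f = s + Finsupp.single i 1)
    (hv : s + Finsupp.single j 1 ≼[m] v) :
    (X j * pderiv i f).coeff v = 0 ↔ v ≠ s + Finsupp.single j 1 := by
  constructor
  · rintro h rfl
    rw [add_comm, coeff_X_mul_pderiv_single_add, ← hf] at h
    exact mul_ne_zero (m.coeff_degree_ne_zero_iff.2 hf0) (Nat.cast_add_one_ne_zero _) h
  intro hne
  by_contra h
  obtain ⟨w, rfl⟩ : ∃ w, v = Finsupp.single j 1 + w := by
    refine le_iff_exists_add.1 (Finsupp.single_le_iff.2 (Nat.one_le_iff_ne_zero.2 fun hvj => h ?_))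
    classical
    rw [coeff_X_mul', if_neg (Finsupp.notMem_support_iff.2 hvj)]
  rw [coeff_X_mul_pderiv_single_add] at h
  have hws := m.le_degree (mem_support_iff.2 (left_ne_zero_of_mul h))
  rw [hf] at hws
  rw [add_comm (Finsupp.single j 1) w] at hv hne
  simp only [map_add, add_le_add_iff_right] at hws hv
  exact hne (congrArg (· + _) (m.toSyn.injective (le_antisymm hws hv)))

theorem exists_mem_degree_eq_coeff_eq_ite {I : Ideal (MvPolynomial (Fin n) K)}
    (hI : I.IsHomogeneous (homogeneousSubmodule (Fin n) K)) {t : Fin n →₀ ℕ}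
    (ht : t ∈ leadingExponents m I) :
    ∃ f ∈ I, f.IsHomogeneous t.degree ∧ f ≠ 0 ∧ m.degree f = t ∧
      ∀ s ∈ leadingExponents m I, s.degree = t.degree → coeff s f = if s = t then 1 else 0 := by
  obtain ⟨f, hfI, hfd, hf⟩ := exists_mem_coeff_eq_ite hI t
  have hf0 : f ≠ 0 := fun h => by simpa [h] using hf t ht rfl
  refine ⟨f, hfI, hfd, hf0, ?_, hf⟩
  by_contra hne
  apply m.coeff_degree_ne_zero_iff.2 hf0
  rw [hf _ ⟨f, hfI, hf0, rfl⟩ (degree_degree_of_isHomogeneous hfd hf0), if_neg hne]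

theorem exists_det_coeff_linearSubst_transvection_ne_zero [CharZero K]
    {I : Ideal (MvPolynomial (Fin n) K)}
    (hI : I.IsHomogeneous (homogeneousSubmodule (Fin n) K)) {i j : Fin n}
    (hij : Finsupp.single i 1 ≺[m] Finsupp.single j 1) {s : Fin n →₀ ℕ}
    (hs : s + Finsupp.single i 1 ∈ leadingExponents m I) {T : Set (Fin n →₀ ℕ)} [Fintype T]
    [DecidableEq T] (hsT : s + Finsupp.single j 1 ∈ T)
    (hT : ∀ v ∈ T, (v ∈ leadingExponents m I ∨ v = s + Finsupp.single j 1) ∧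
      v.degree = s.degree + 1 ∧ s + Finsupp.single j 1 ≼[m] v) :
    ∃ F : T → MvPolynomial (Fin n) K, (∀ u, F u ∈ I) ∧
      (∀ u, (F u).IsHomogeneous (s.degree + 1)) ∧
      (Matrix.of fun u v : T =>
        (linearSubst (A := Polynomial K) (Matrix.transvection i j .X) (F u)).coeff v.1).det ≠
          0 := by
  set t := s + Finsupp.single i 1
  set τ : T := ⟨s + Finsupp.single j 1, hsT⟩
  have htτ : t ≺[m] τ.1 := by simpa only [t, τ, map_add, add_lt_add_iff_left] using hij
  have hdeg : t.degree = s.degree + 1 := by simp [t]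
  have hmem (v : T) (hv : v ≠ τ) : v.1 ∈ leadingExponents m I :=
    (hT v v.2).1.resolve_right fun h => hv (Subtype.ext h)
  let e (u : T) : Fin n →₀ ℕ := if u = τ then t else u
  have he (u : T) : e u ∈ leadingExponents m I ∧ (e u).degree = s.degree + 1 := by
    by_cases hu : u = τ
    · simpa only [e, if_pos hu] using ⟨hs, hdeg⟩
    · simpa only [e, if_neg hu] using ⟨hmem u hu, (hT u u.2).2.1⟩
  choose F hFI hFd hF0 hFe hF using fun u => exists_mem_degree_eq_coeff_eq_ite hI (he u).1
  have hFτ : m.degree (F τ) = t := by simp [hFe, e]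
  simp only [(he _).2] at hFd hF
  refine ⟨F, hFI, hFd, det_ne_zero_of_coeff_zero_eq_of_coeff_one_eq (τ := τ)
    (fun u hu v hv => ?_) (fun v => ?_) fun v => ?_⟩
  · rw [Matrix.of_apply, coeff_zero_coeff_linearSubst_transvection_X,
      hF u v (hmem v hv) (hT v v.2).2.1]
    simp only [e, if_neg hu, Subtype.coe_inj]
  · rw [Matrix.of_apply, coeff_zero_coeff_linearSubst_transvection_X]
    exact m.coeff_eq_zero_of_lt (hFτ ▸ htτ.trans_le (hT v v.2).2.2)
  · rw [Matrix.of_apply, coeff_one_coeff_linearSubst_transvection_X,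
      coeff_X_mul_pderiv_eq_zero_iff (hF0 τ) hFτ (hT v v.2).2.2, Ne, Ne, Subtype.ext_iff]

theorem exists_ne_zero_leadingExponents_map_transvection_ne [CharZero K]
    {I : Ideal (MvPolynomial (Fin n) K)}
    (hI : I.IsHomogeneous (homogeneousSubmodule (Fin n) K)) {i j : Fin n}
    (hij : Finsupp.single i 1 ≺[m] Finsupp.single j 1) {s : Fin n →₀ ℕ}
    (hsi : s + Finsupp.single i 1 ∈ leadingExponents m I)
    (hsj : s + Finsupp.single j 1 ∉ leadingExponents m I) :
    ∃ q : Polynomial K, q ≠ 0 ∧ ∀ p, q.eval p ≠ 0 →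
      leadingExponents m (I.map (linearSubst (Matrix.transvection i j p))) ≠
        leadingExponents m I := by
  classical
  set t := s + Finsupp.single j 1 with ht
  set T := {v | (v ∈ leadingExponents m I ∨ v = t) ∧ v.degree = s.degree + 1 ∧ t ≼[m] v}
  have : Fintype T := ((finite_setOf_mem_and_degree_eq Set.univ (s.degree + 1)).subset
    fun v hv => ⟨trivial, hv.2.1⟩).fintype
  have htT : t ∈ T := ⟨Or.inr rfl, by simp [ht], le_rfl⟩
  obtain ⟨F, hFI, hFd, hdet⟩ :=
    exists_det_coeff_linearSubst_transvection_ne_zero hI hij hsi htT fun v hv => hv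
  refine ⟨_, hdet, fun p hp hM => ?_⟩
  have hmap (f : MvPolynomial (Fin n) K) (v : Fin n →₀ ℕ) :
      ((linearSubst (Matrix.transvection i j Polynomial.X) f).coeff v).eval p =
        (linearSubst (Matrix.transvection i j p) f).coeff v := by
    rw [← mapMatrix_aeval_transvection_X i j p, ← map_linearSubst, coeff_map]
    simp
  rw [← Polynomial.coe_evalRingHom, RingHom.map_det] at hp
  obtain ⟨G, hGI, hGd, hG⟩ := exists_mem_coeff_eq_of_det_ne_zero
    (fun u => Ideal.mem_map_of_mem (linearSubst (Matrix.transvection i j p)) (hFI u))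
    (fun u => isHomogeneous_linearSubst _ (hFd u)) Subtype.val
    (by simpa only [RingHom.mapMatrix_apply, Matrix.map, Matrix.of_apply,
      Polynomial.coe_evalRingHom, hmap] using hp) (Pi.single ⟨t, htT⟩ 1)
  have hGt : G.coeff t = 1 := by simpa using hG ⟨t, htT⟩
  have hG0 : G ≠ 0 := fun h => by simp [h] at hGt
  have hGM : m.degree G ∈ leadingExponents m I := hM ▸ ⟨G, hGI, hG0, rfl⟩
  have hGT : m.degree G ∈ T := ⟨Or.inl hGM, degree_degree_of_isHomogeneous hGd hG0,
    m.le_degree (mem_support_iff.2 (by simp [hGt]))⟩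
  refine m.coeff_degree_ne_zero_iff.2 hG0 ((hG ⟨_, hGT⟩).trans (Pi.single_eq_of_ne ?_ _))
  rintro h
  rw [Subtype.mk_eq_mk] at h
  exact hsj (h ▸ hGM)

theorem IsGin.monomial_add_single_one_mem [CharZero K] {I J : Ideal (MvPolynomial (Fin n) K)}
    (h : IsGin m I J) (hI : I.IsHomogeneous (homogeneousSubmodule (Fin n) K)) {i j : Fin n}
    (hij : Finsupp.single i 1 ≺[m] Finsupp.single j 1) {s : Fin n →₀ ℕ}
    (hs : monomial (s + Finsupp.single i 1) (1 : K) ∈ J) :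
    monomial (s + Finsupp.single j 1) (1 : K) ∈ J := by
  obtain ⟨U, hU, ⟨g, hg⟩, hJ⟩ := h
  rw [← hJ g hg, monomial_mem_leadingTermIdeal_iff] at hs ⊢
  by_contra hsj
  obtain ⟨q, hq, hne⟩ := exists_ne_zero_leadingExponents_map_transvection_ne
    (isHomogeneous_map_coordChange g hI) hij hs hsj
  have hne' : i ≠ j := fun h => (h ▸ hij).false
  let τ (p : K) : GL (Fin n) K := Matrix.GeneralLinearGroup.mkOfDetNeZero
    (Matrix.transvection i j p) (by rw [Matrix.det_transvection_of_ne _ _ hne']; exact one_ne_zero)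
  obtain ⟨r, hr, hrU⟩ := hU.exists_forall_eval_ne_zero_mem (γ := fun p => g * τ p) (p₀ := 0)
    (g.1.map Polynomial.C * Matrix.transvection i j Polynomial.X)
    (fun p => by
      rw [map_mul, mapMatrix_aeval_transvection_X]
      ext a b
      simp [Matrix.mul_apply, τ])
    (by
      have hτ : τ 0 = 1 := Units.ext (Matrix.transvection_zero i j)
      rwa [hτ, mul_one])
  obtain ⟨p, hp⟩ : ∃ p, (q * r).eval p ≠ 0 := by
    by_contra! h
    exact mul_ne_zero hq hr (Polynomial.funext fun p => by rw [h, Polynomial.eval_zero])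
  rw [Polynomial.eval_mul] at hp
  refine hne p (left_ne_zero_of_mul hp) ?_
  have hJp := hJ _ (hrU p (right_ne_zero_of_mul hp))
  rw [← hJ g hg, map_coordChange_mul] at hJp
  ext t
  rw [← monomial_mem_leadingTermIdeal_iff, ← monomial_mem_leadingTermIdeal_iff, ← hJp]
  rfl

theorem IsGin.monomial_add_single_mem [CharZero K] {I J : Ideal (MvPolynomial (Fin n) K)}
    (h : IsGin m I J) (hI : I.IsHomogeneous (homogeneousSubmodule (Fin n) K)) {i j : Fin n}
    (hij : Finsupp.single i 1 ≺[m] Finsupp.single j 1) {s : Fin n →₀ ℕ} {k : ℕ}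
    (hs : monomial (s + Finsupp.single i k) (1 : K) ∈ J) :
    monomial (s + Finsupp.single j k) (1 : K) ∈ J := by
  induction k generalizing s with
  | zero => simpa using hs
  | succ k ih =>
    rw [Finsupp.single_add, ← add_assoc] at hs
    have hs' := h.monomial_add_single_one_mem hI hij hs
    rw [add_right_comm] at hs'
    rw [add_comm k, Finsupp.single_add, ← add_assoc]
    exact ih hs'

end StrongStability

/-! ### Powers of the last variable -/

section LastVariable

variable {K : Type*} [Field K] {n : ℕ}

theorem apply_last_le_of_degRevLex_lt {t u : Fin (n + 1) →₀ ℕ} (hd : t.degree = u.degree)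
    (h : t ≺[degRevLex (n + 1)] u) : u (Fin.last n) ≤ t (Fin.last n) := by
  rcases (degRevLex_lt_iff t u).1 h with hlt | ⟨-, i, heq, hlt⟩
  · exact absurd hd hlt.ne
  · rcases (Fin.le_last i).eq_or_lt with rfl | hi
    exacts [hlt.le, (heq _ hi).ge]

theorem mem_leadingExponents_of_mem_sup_span_X_last_pow {I : Ideal (MvPolynomial (Fin (n + 1)) K)}
    (hI : I.IsHomogeneous (homogeneousSubmodule (Fin (n + 1)) K)) {s : ℕ} {t : Fin (n + 1) →₀ ℕ}
    (hts : t (Fin.last n) < s)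
    (ht : t ∈ leadingExponents (degRevLex (n + 1)) (I ⊔ Ideal.span {X (Fin.last n) ^ s})) :
    t ∈ leadingExponents (degRevLex (n + 1)) I := by
  classical
  obtain ⟨f, hf, hf0, rfl⟩ := ht
  set t := (degRevLex (n + 1)).degree f
  obtain ⟨h, hh, _, hq, rfl⟩ := Submodule.mem_sup.1 hf
  obtain ⟨q, rfl⟩ := Ideal.mem_span_singleton'.1 hq
  have hcoeff {u : Fin (n + 1) →₀ ℕ} (hu : u (Fin.last n) < s) :
      coeff u (h + q * X (Fin.last n) ^ s) = coeff u h := by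
    rw [coeff_add, X_pow_eq_monomial, coeff_mul_monomial', if_neg, add_zero]
    exact fun hle => hu.not_ge (by simpa using hle (Fin.last n))
  have hne : coeff t (homogeneousComponent t.degree h) ≠ 0 := by
    rw [coeff_homogeneousComponent, if_pos rfl, ← hcoeff hts]
    exact (degRevLex (n + 1)).coeff_degree_ne_zero_iff.2 hf0
  refine ⟨_, homogeneousComponent_mem_of_mem hI hh t.degree,
    fun h0 => hne (by rw [h0, coeff_zero]), degree_eq_of_coeff_ne_zero hne fun u hu => ?_⟩
  by_contra! htu
  rw [coeff_homogeneousComponent, ne_eq, ite_eq_right_iff, Classical.not_imp] at hu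
  refine htu.not_ge ((degRevLex (n + 1)).le_degree (mem_support_iff.2 ?_))
  rw [hcoeff ((apply_last_le_of_degRevLex_lt hu.1.symm htu).trans_lt hts)]
  exact hu.2

theorem leadingExponents_sup_span_X_last_pow {I : Ideal (MvPolynomial (Fin (n + 1)) K)}
    (hI : I.IsHomogeneous (homogeneousSubmodule (Fin (n + 1)) K)) (s : ℕ) :
    leadingExponents (degRevLex (n + 1)) (I ⊔ Ideal.span {X (Fin.last n) ^ s}) =
      leadingExponents (degRevLex (n + 1)) I ∪ {t | s ≤ t (Fin.last n)} := by
  refine Set.Subset.antisymm (fun t ht => or_iff_not_imp_right.2 fun hts =>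
    mem_leadingExponents_of_mem_sup_span_X_last_pow hI (not_le.1 hts) ht)
    (Set.union_subset (leadingExponents_mono le_sup_left) fun t ht => ?_)
  refine isUpperSet_leadingExponents _ (Finsupp.single_le_iff.2 ht) ⟨X (Fin.last n) ^ s,
    Ideal.mem_sup_right (Ideal.mem_span_singleton_self _), pow_ne_zero _ (X_ne_zero _), ?_⟩
  classical
  rw [X_pow_eq_monomial, MonomialOrder.degree_monomial, if_neg one_ne_zero]

theorem isHomogeneous_sup_span_X_pow {σ R : Type*} [CommRing R] {I : Ideal (MvPolynomial σ R)}
    (hI : I.IsHomogeneous (homogeneousSubmodule σ R)) (i : σ) (s : ℕ) :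
    (I ⊔ Ideal.span {X i ^ s}).IsHomogeneous (homogeneousSubmodule σ R) := by
  refine hI.sup (Ideal.homogeneous_span _ _ ?_)
  rintro _ rfl
  exact ⟨s, isHomogeneous_X_pow i s⟩

end LastVariable

/-! ### Generic linear forms -/

section LinearForm

variable {K : Type*} [Field K] {n : ℕ}

theorem exists_row_eq_of_ne_zero {a : Fin n → K} (ha : a ≠ 0) (k : Fin n) :
    ∃ g : GL (Fin n) K, g.1 k = a := by
  obtain ⟨j, hj⟩ := Function.ne_iff.1 ha
  have hdet : (Matrix.updateRow 1 j a).det = a j := by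
    have h := Matrix.det_updateRow_sum (1 : Matrix (Fin n) (Fin n) K) j a
    rwa [Matrix.det_one, smul_eq_mul, mul_one, show ∑ i, a i • (1 : Matrix _ _ K) i = a by
      ext1 i; simp [Matrix.one_apply]] at h
  refine ⟨.mkOfDetNeZero ((Matrix.updateRow 1 j a).submatrix (Equiv.swap j k) id) ?_, ?_⟩
  · rw [Matrix.det_permute, hdet]
    exact mul_ne_zero ((Equiv.Perm.sign _).isUnit.map (Int.castRingHom K)).ne_zero hj
  · ext1 i
    simp [Matrix.GeneralLinearGroup.mkOfDetNeZero]

theorem exists_coordChange_eq_smul_X {L : MvPolynomial (Fin n) K} (hL : L.IsHomogeneous 1)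
    (k : Fin n) : ∃ (g : GL (Fin n) K) (c : K), coordChange g L = c • X k := by
  rcases eq_or_ne L 0 with rfl | hL0
  · exact ⟨1, 0, by rw [map_zero, zero_smul]⟩
  rw [← mem_homogeneousSubmodule, homogeneousSubmodule_one_eq_span_X,
    Submodule.mem_span_range_iff_exists_fun] at hL
  obtain ⟨a, rfl⟩ := hL
  obtain ⟨g, hg⟩ := exists_row_eq_of_ne_zero (a := a) (by rintro rfl; simp at hL0) k
  have hgX : coordChange g (X k) = ∑ i, a i • X i := by
    rw [coordChange_eq_linearSubst, linearSubst_X, hg]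
    simp only [smul_eq_C_mul]
  refine ⟨g⁻¹, 1, ?_⟩
  rw [← hgX, ← AlgHom.comp_apply, coordChange_comp, mul_inv_cancel, coordChange_one,
    AlgHom.id_apply, one_smul]

theorem IsGin.hilbertFunction_sup_span_pow_le [Infinite K]
    {I J : Ideal (MvPolynomial (Fin (n + 1)) K)} (hJ : IsGin (degRevLex (n + 1)) I J)
    (hI : I.IsHomogeneous (homogeneousSubmodule (Fin (n + 1)) K))
    {L : MvPolynomial (Fin (n + 1)) K} (hL : L.IsHomogeneous 1) (s d : ℕ) :
    hilbertFunction (I ⊔ Ideal.span {L ^ s}) d ≤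
      hilbertFunction (J ⊔ Ideal.span {X (Fin.last n) ^ s}) d := by
  have hspec (g : GL (Fin (n + 1)) K) :
      (genericTransform I ⊔ Ideal.span {X (Fin.last n) ^ s}).map (specialize g) =
        I.map (coordChange g) ⊔ Ideal.span {X (Fin.last n) ^ s} := by
    rw [Ideal.map_sup, genericTransform_map_specialize, Ideal.map_span, Set.image_singleton,
      map_pow, specialize, map_X]
  obtain ⟨U, hU, hUn, hUJ⟩ := hJ
  obtain ⟨V, hV, hVn, hVle⟩ := exists_isZariskiOpen_hilbertFunction_map_specialize_le
    (isHomogeneous_sup_span_X_pow (isHomogeneous_genericTransform hI) (Fin.last n) s)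
  obtain ⟨g, hgU, hgV⟩ := hU.inter_nonempty hV hUn hVn
  obtain ⟨h, c, hh⟩ := exists_coordChange_eq_smul_X hL (Fin.last n)
  calc hilbertFunction (I ⊔ Ideal.span {L ^ s}) d
    _ = hilbertFunction ((I ⊔ Ideal.span {L ^ s}).map (coordChange h)) d := by
      rw [hilbertFunction_map_coordChange]
    _ ≤ hilbertFunction (I.map (coordChange h) ⊔ Ideal.span {X (Fin.last n) ^ s}) d := by
      refine hilbertFunction_mono ?_ d
      rw [Ideal.map_sup, Ideal.map_span, Set.image_singleton, map_pow, hh, smul_pow, smul_eq_C_mul]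
      exact sup_le_sup_left (Ideal.span_singleton_le_span_singleton.2 (dvd_mul_left _ _)) _
    _ ≤ hilbertFunction (I.map (coordChange g) ⊔ Ideal.span {X (Fin.last n) ^ s}) d := by
      simpa only [hspec] using hVle g hgV h d
    _ = hilbertFunction (J ⊔ Ideal.span {X (Fin.last n) ^ s}) d := by
      have hgI := isHomogeneous_map_coordChange g hI
      have hJ := (isMonomialIdeal_leadingTermIdeal (m := degRevLex (n + 1))
        (I.map (coordChange g))).isHomogeneous
      rw [← hUJ g hgU]
      simp only [
        hilbertFunction_eq_ncard (degRevLex (n + 1)) (isHomogeneous_sup_span_X_pow hgI _ _),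
        hilbertFunction_eq_ncard (degRevLex (n + 1)) (isHomogeneous_sup_span_X_pow hJ _ _),
        leadingExponents_sup_span_X_last_pow hgI, leadingExponents_sup_span_X_last_pow hJ,
        leadingExponents_leadingTermIdeal]

end LinearForm

/-! ### The strong Lefschetz property -/

section StrongLefschetz

variable {K : Type*} [Field K] {n : ℕ}

theorem finrank_map_mk_add_hilbertFunction {I J : Ideal (MvPolynomial (Fin n) K)} (h : I ≤ J)
    (d : ℕ) :
    Module.finrank K ↥((J.restrictScalars K ⊓ homogeneousSubmodule (Fin n) K d).map
      (Ideal.Quotient.mkₐ K I).toLinearMap) + hilbertFunction I d = hilbertFunction J d := by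
  set V : Submodule K (MvPolynomial (Fin n) K) :=
    J.restrictScalars K ⊓ homogeneousSubmodule (Fin n) K d
  set π := (Ideal.Quotient.mkₐ K I).toLinearMap
  have hker : (LinearMap.ker (π.domRestrict V)).map V.subtype =
      I.restrictScalars K ⊓ homogeneousSubmodule (Fin n) K d := by
    have hπ : LinearMap.ker π = I.restrictScalars K :=
      SetLike.ext fun f => Ideal.Quotient.eq_zero_iff_mem
    rw [LinearMap.ker_domRestrict, Submodule.map_comap_subtype, hπ, inf_right_comm,
      inf_eq_right.2 (show I.restrictScalars K ≤ J.restrictScalars K from h)]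
  rw [hilbertFunction, ← hker, Submodule.finrank_map_subtype_eq, ← LinearMap.range_domRestrict,
    LinearMap.finrank_range_add_finrank_ker]
  rfl

theorem finrank_quotientComponent_add_hilbertFunction (I : Ideal (MvPolynomial (Fin n) K))
    (d : ℕ) :
    Module.finrank K (quotientComponent I d) + hilbertFunction I d =
      hilbertFunction (⊤ : Ideal (MvPolynomial (Fin n) K)) d := by
  rw [← finrank_map_mk_add_hilbertFunction (le_top (a := I))]
  rw [quotientComponent, Submodule.restrictScalars_top, top_inf_eq]

theorem IsMonomialIdeal.finrank_quotientComponent_eq_ncard {J : Ideal (MvPolynomial (Fin n) K)}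
    (hJ : IsMonomialIdeal J) (d : ℕ) :
    Module.finrank K (quotientComponent J d) =
      {t : Fin n →₀ ℕ | monomial t (1 : K) ∉ J ∧ t.degree = d}.ncard := by
  have htop : IsMonomialIdeal (⊤ : Ideal (MvPolynomial (Fin n) K)) :=
    ⟨{0}, by simp⟩
  have hadd := finrank_quotientComponent_add_hilbertFunction J d
  have hfin : {t : Fin n →₀ ℕ | monomial t (1 : K) ∉ J ∧ t.degree = d}.Finite :=
    (Finsupp.finite_of_degree_eq d).subset fun t ht => ht.2
  have hfin' : {t : Fin n →₀ ℕ | monomial t (1 : K) ∈ J ∧ t.degree = d}.Finite :=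
    (Finsupp.finite_of_degree_eq d).subset fun t ht => ht.2
  rw [hJ.hilbertFunction_eq_ncard, htop.hilbertFunction_eq_ncard] at hadd
  refine Nat.add_right_cancel (hadd.trans ?_)
  rw [← Set.ncard_union_eq (Set.disjoint_left.2 fun t ht ht' => ht.1 ht'.1) hfin hfin']
  congr 1
  ext t
  simp only [Submodule.mem_top, true_and, Set.mem_ofPred_eq, Set.mem_union]
  tauto

theorem HasSLP.exists_isHomogeneous_min_add_hilbertFunction_le
    {I : Ideal (MvPolynomial (Fin n) K)} (h : HasSLP (quotientComponent I)) :
    ∃ L : MvPolynomial (Fin n) K, L.IsHomogeneous 1 ∧ ∀ i s : ℕ, 1 ≤ s →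
      min (Module.finrank K (quotientComponent I i))
          (Module.finrank K (quotientComponent I (i + s))) + hilbertFunction I (i + s) ≤
        hilbertFunction (I ⊔ Ideal.span {L ^ s}) (i + s) := by
  obtain ⟨_, ⟨L, hL, rfl⟩, hrank⟩ := h
  refine ⟨L, hL, fun i s hs => ?_⟩
  rw [← hrank i s hs, ← finrank_map_mk_add_hilbertFunction (le_sup_left : I ≤ _)]
  gcongr
  refine Submodule.finrank_mono ?_
  rintro _ ⟨_, ⟨f, hf, rfl⟩, rfl⟩
  refine ⟨L ^ s * f, ⟨?_, ?_⟩, ?_⟩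
  · exact Ideal.mem_sup_right (Ideal.mul_mem_right _ _ (Ideal.mem_span_singleton_self _))
  · rw [add_comm]
    simpa using (hL.pow s).mul hf
  · simp

theorem IsMonomialIdeal.hilbertFunction_sup_span_X_last_pow
    {J : Ideal (MvPolynomial (Fin (n + 1)) K)} (hJ : IsMonomialIdeal J) (s d : ℕ) :
    hilbertFunction (J ⊔ Ideal.span {X (Fin.last n) ^ s}) d =
      {t : Fin (n + 1) →₀ ℕ | (monomial t (1 : K) ∉ J ∧ t.degree = d) ∧ s ≤ t (Fin.last n)}.ncard +
        hilbertFunction J d := by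
  have hfin : {t : Fin (n + 1) →₀ ℕ | (monomial t (1 : K) ∉ J ∧ t.degree = d) ∧
      s ≤ t (Fin.last n)}.Finite := (Finsupp.finite_of_degree_eq d).subset fun t ht => ht.1.2
  have hfin' : {t : Fin (n + 1) →₀ ℕ | monomial t (1 : K) ∈ J ∧ t.degree = d}.Finite :=
    (Finsupp.finite_of_degree_eq d).subset fun t ht => ht.2
  rw [Lefschetz.hilbertFunction_eq_ncard (degRevLex (n + 1))
    (isHomogeneous_sup_span_X_pow hJ.isHomogeneous _ _),
    leadingExponents_sup_span_X_last_pow hJ.isHomogeneous, hJ.leadingExponents_eq,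
    hJ.hilbertFunction_eq_ncard, ← Set.ncard_union_eq
      (Set.disjoint_left.2 fun t ht ht' => ht.1.1 ht'.1) hfin hfin']
  congr 1
  ext t
  simp only [Set.mem_union, Set.mem_ofPred_eq]
  tauto

theorem IsMonomialIdeal.monomial_mem_of_min_add_hilbertFunction_le
    {J : Ideal (MvPolynomial (Fin (n + 1)) K)} (hJ : IsMonomialIdeal J) {i s : ℕ}
    (h : min (Module.finrank K (quotientComponent J i))
        (Module.finrank K (quotientComponent J (i + s))) + hilbertFunction J (i + s) ≤
      hilbertFunction (J ⊔ Ideal.span {X (Fin.last n) ^ s}) (i + s)) :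
    (∀ u, u.degree = i → monomial (u + Finsupp.single (Fin.last n) s) (1 : K) ∈ J →
      monomial u (1 : K) ∈ J) ∨
    ∀ v, v.degree = i + s → v (Fin.last n) < s → monomial v (1 : K) ∈ J := by
  rw [hJ.hilbertFunction_sup_span_X_last_pow, add_le_add_iff_right,
    hJ.finrank_quotientComponent_eq_ncard, hJ.finrank_quotientComponent_eq_ncard,
    min_le_iff] at h
  set N : ℕ → Set (Fin (n + 1) →₀ ℕ) := fun d => {t | monomial t (1 : K) ∉ J ∧ t.degree = d}
  have hN (d : ℕ) : (N d).Finite := (Finsupp.finite_of_degree_eq d).subset fun t ht => ht.2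
  set D := {t | t ∈ N (i + s) ∧ s ≤ t (Fin.last n)}
  have hDimage : D ⊆ (· + Finsupp.single (Fin.last n) s) '' N i := by
    rintro t ⟨⟨htJ, htd⟩, hts⟩
    obtain ⟨u, rfl⟩ := exists_add_of_le (Finsupp.single_le_iff.2 hts)
    rw [map_add, Finsupp.degree_single] at htd
    exact ⟨u, ⟨fun hu => htJ (isUpperSet_setOf_monomial_mem J le_add_self hu), by omega⟩,
      add_comm _ _⟩
  rcases h with hle | hle
  · have heq := Set.eq_of_subset_of_ncard_le hDimage ((Set.ncard_image_le (hN i)).trans hle)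
      ((hN i).image _)
    refine Or.inl fun u hud hu => ?_
    by_contra huJ
    exact (heq.ge ⟨u, ⟨huJ, hud⟩, rfl⟩).1.1 hu
  · have heq := Set.eq_of_subset_of_ncard_le (fun t ht => ht.1) hle (hN _)
    refine Or.inr fun v hvd hvs => ?_
    by_contra hvJ
    exact hvs.not_ge (heq.ge ⟨hvJ, hvd⟩).2

theorem IsGin.monomial_mem_of_last_lt [Infinite K] {I J : Ideal (MvPolynomial (Fin (n + 1)) K)}
    (hJ : IsGin (degRevLex (n + 1)) I J)
    (hI : I.IsHomogeneous (homogeneousSubmodule (Fin (n + 1)) K))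
    (hSLP : HasSLP (quotientComponent I)) {t t' : Fin (n + 1) →₀ ℕ}
    (ht : IsMinimalGenerator J t) (hd : t'.degree = t.degree)
    (hlast : t' (Fin.last n) < t (Fin.last n)) : monomial t' (1 : K) ∈ J := by
  obtain ⟨L, hL, hrank⟩ := hSLP.exists_isHomogeneous_min_add_hilbertFunction_le
  obtain ⟨u, hu⟩ := exists_add_of_le (Finsupp.single_le_iff.2 (le_refl (t (Fin.last n))))
  replace hu := hu.trans (add_comm _ _)
  have htd := congrArg Finsupp.degree hu
  rw [map_add, Finsupp.degree_single] at htd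
  set s := t (Fin.last n)
  have hfinrank (d : ℕ) :
      Module.finrank K (quotientComponent J d) = Module.finrank K (quotientComponent I d) := by
    have hJd := finrank_quotientComponent_add_hilbertFunction J d
    rw [← finrank_quotientComponent_add_hilbertFunction I, hJ.hilbertFunction_eq hI] at hJd
    exact Nat.add_right_cancel hJd
  have hle := (hrank u.degree s (Nat.one_le_of_lt hlast)).trans
    (hJ.hilbertFunction_sup_span_pow_le hI hL s _)
  rw [← hJ.hilbertFunction_eq hI, ← hfinrank, ← hfinrank] at hle
  rcases hJ.isMonomialIdeal.monomial_mem_of_min_add_hilbertFunction_le hle with hinj | hsurj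
  · have htu := ht.2 (hinj u rfl (hu ▸ ht.1)) (hu ▸ le_self_add)
    have hdeg := Finsupp.degree_mono htu
    omega
  · exact hsurj t' (hd.trans htd) hlast

end StrongLefschetz

/-! ### Three variables -/

section ThreeVariables

variable {K : Type*} [Field K]

theorem degRevLex_single_lt_single {n : ℕ} {i j : Fin n} (h : j < i) :
    Finsupp.single i 1 ≺[degRevLex n] Finsupp.single j 1 := by
  refine (degRevLex_lt_iff _ _).2 (Or.inr ⟨?_, i, fun l hl => ?_, ?_⟩)
  · rw [Finsupp.degree_single, Finsupp.degree_single]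
  · rw [Finsupp.single_eq_of_ne hl.ne', Finsupp.single_eq_of_ne (h.trans hl).ne']
  · rw [Finsupp.single_eq_same, Finsupp.single_eq_of_ne h.ne']
    exact one_pos

theorem apply_lt_of_degRevLex_three_lt {t u : Fin 3 →₀ ℕ} (hd : t.degree = u.degree)
    (h : t ≺[degRevLex 3] u) : u 2 < t 2 ∨ u 2 = t 2 ∧ u 1 < t 1 := by
  rcases (degRevLex_lt_iff t u).1 h with hlt | ⟨-, i, heq, hlt⟩
  · exact absurd hd hlt.ne
  · fin_cases i
    · have h1 : t 1 = u 1 := heq 1 (by decide)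
      have h2 : t 2 = u 2 := heq 2 (by decide)
      have h0 : u 0 < t 0 := hlt
      simp only [Finsupp.degree_eq_sum, Fin.sum_univ_three] at hd
      omega
    · exact Or.inr ⟨(heq 2 (by decide)).symm, hlt⟩
    · exact Or.inl hlt

theorem IsGin.monomial_mem_of_apply_one_le [CharZero K] {I J : Ideal (MvPolynomial (Fin 3) K)}
    (hJ : IsGin (degRevLex 3) I J) (hI : I.IsHomogeneous (homogeneousSubmodule (Fin 3) K))
    {t t' : Fin 3 →₀ ℕ} (ht : monomial t (1 : K) ∈ J) (hd : t'.degree = t.degree)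
    (h2 : t' 2 = t 2) (h1 : t' 1 ≤ t 1) : monomial t' (1 : K) ∈ J := by
  obtain ⟨k, hk⟩ := exists_add_of_le h1
  simp only [Finsupp.degree_eq_sum, Fin.sum_univ_three] at hd
  obtain ⟨s, rfl⟩ := exists_add_of_le (Finsupp.single_le_iff.2 (show k ≤ t' 0 by omega))
  rw [add_comm] at hk h2 hd ⊢
  simp only [Finsupp.add_apply, Finsupp.single_eq_same, Finsupp.single_eq_of_ne, ne_eq,
    Fin.reduceEq, not_false_eq_true, add_zero] at hk h2 hd
  have hts : t = s + Finsupp.single 1 k := by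
    ext i
    rw [Finsupp.add_apply]
    match i with
    | 0 => rw [Finsupp.single_eq_of_ne (by decide)]; omega
    | 1 => rw [Finsupp.single_eq_same]; omega
    | 2 => rw [Finsupp.single_eq_of_ne (by decide)]; omega
  exact hJ.monomial_add_single_mem hI (degRevLex_single_lt_single (by decide)) (hts ▸ ht)

theorem IsGin.isAlmostRevlex [CharZero K] {I J : Ideal (MvPolynomial (Fin 3) K)}
    (hJ : IsGin (degRevLex 3) I J) (hI : I.IsHomogeneous (homogeneousSubmodule (Fin 3) K))
    (hSLP : HasSLP (quotientComponent I)) : IsAlmostRevlex J := by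
  refine ⟨hJ.isMonomialIdeal, fun t ht t' hd hlt => ?_⟩
  rcases apply_lt_of_degRevLex_three_lt hd.symm hlt with h2 | ⟨h2, h1⟩
  · exact hJ.monomial_mem_of_last_lt hI hSLP ht hd h2
  · exact hJ.monomial_mem_of_apply_one_le hI ht.1 hd h2 h1.le

end ThreeVariables

end Lefschetz

theorem mainTheorem8 {K : Type*} [Field K] [CharZero K]
    (I : Ideal (MvPolynomial (Fin 3) K))
    (hI : I.IsHomogeneous (MvPolynomial.homogeneousSubmodule (Fin 3) K))
    (hSLP : Lefschetz.HasSLP (Lefschetz.quotientComponent I)) :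
    -- `rgin I` is well defined
    (∀ J, Lefschetz.IsGin (Lefschetz.degRevLex 3) I J ↔ J = Lefschetz.rgin I) ∧
    -- it is an almost revlex ideal
    Lefschetz.IsAlmostRevlex (Lefschetz.rgin I) ∧
    -- it is the only almost revlex ideal with the Hilbert function of `I`
    Lefschetz.hilbertFunction (Lefschetz.rgin I) = Lefschetz.hilbertFunction I ∧
    (∀ J : Ideal (MvPolynomial (Fin 3) K), Lefschetz.IsAlmostRevlex J →
      Lefschetz.hilbertFunction J = Lefschetz.hilbertFunction I → J = Lefschetz.rgin I) ∧
    -- ideals as above with the same Hilbert function have the same `rgin`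
    (∀ I' : Ideal (MvPolynomial (Fin 3) K),
      I'.IsHomogeneous (MvPolynomial.homogeneousSubmodule (Fin 3) K) →
      Lefschetz.HasSLP (Lefschetz.quotientComponent I') →
      Lefschetz.hilbertFunction I' = Lefschetz.hilbertFunction I →
      Lefschetz.rgin I' = Lefschetz.rgin I) := by
  have hgin := Lefschetz.isGin_rgin hI
  have hrev := hgin.isAlmostRevlex hI hSLP
  have hhilb := hgin.hilbertFunction_eq hI
  refine ⟨fun J => ⟨fun hJ => hJ.unique hgin, fun hJ => hJ ▸ hgin⟩, hrev, hhilb,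
    fun J hJ hJI => hJ.eq_of_hilbertFunction_eq hrev (hJI.trans hhilb.symm),
    fun I' hI' hSLP' hII' => ?_⟩
  have hgin' := Lefschetz.isGin_rgin hI'
  exact (hgin'.isAlmostRevlex hI' hSLP').eq_of_hilbertFunction_eq hrev
    (((hgin'.hilbertFunction_eq hI').trans hII').trans hhilb.symm)
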